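/- Write $e(x)=\exp(2\pi i x)$ and $\Gamma=\mathrm{SL}_2(\mathbb Z)$. Let $k\in\mathbb Z$, let $L\in\mathrm{Mat}_N(\mathbb Z)$ be symmetric with even diagonal entries, and put $L[x]=x^{\mathrm{tr}}Lx$ for vectors or matrices $x$ of compatible size. A Jacobi form of weight $k$ and index $L$ is a holomorphic function $\phi:\mathbb H\times\mathbb C^N\to\mathbb C$ such that for all $\gamma=\left(\begin{smallmatrix}a&b\\c&d\end{smallmatrix}\right)\in\Gamma$ and $\lambda,\mu\in\mathbb Z^N$ $$\phi(\tau,z)=(c\tau+d)^{-k}\,e\Big(-\frac{c\,L[z+\lambda\tau+\mu]}{2(c\tau+d)}+\frac{\tau L[\lambda]}{2}+\lambda^{\mathrm{tr}}Lz\Big)\,\phi\Big(\frac{a\tau+b}{c\tau+d},\frac{z+\lambda\tau+\mu}{c\tau+d}\Big),$$ and such that $e(\tau L[\alpha]/2)\,\phi(\tau,\alpha\tau+\beta)=O(1)$ as $\operatorname{Im}\tau\to\infty$ for all $\alpha,\beta\in\mathbb Q^N$. Let $J_{k,L}$ be the space of these forms, and $M_\kappa$ the space of elliptic modular forms of weight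 $\kappa$ for $\Gamma$. For $s\in\mathrm{Mat}_{N,N'}(\mathbb Z)$ put $\phi[s](\tau,z)=\phi(\tau,sz)$. For an integer $l>0$ put $$(\phi|_{k,L}V_l)(\tau,z)=l^{k-1}\sum_{\gamma\in\Gamma\backslash\{\gamma\in\mathrm{Mat}_2(\mathbb Z):\det\gamma=l\}}(c\tau+d)^{-k}\,e\Big(-\frac{c\,l\,L[z]}{2(c\tau+d)}\Big)\,\phi\Big(\gamma\tau,\frac{lz}{c\tau+d}\Big),$$ $$(f|T_l)(\tau)=l^{\kappa-1}\sum_{\gamma\in\Gamma\backslash\{\gamma\in\mathrm{Mat}_2(\mathbb Z):\det\gamma=l\}}(c\tau+d)^{-\kappa}f(\gamma\tau)\qquad(f\in M_\kappa).$$ For a Jacobi form $\phi$ of weight $k$ and rank one index $(2m)$ and $\nu\ge0$ put $$\mathcal D_{2\nu}(\phi)=\sum_{0\le\mu\le\nu}\frac{(-1)^\mu(2\nu)!\,(k+2\nu-\mu-2)!}{\mu!\,(2\nu-2\mu)!\,(k+\nu-2)!}\Big(\frac{\partial_z}{2\pi i}\Big)^{2\nu-2\mu}\Big(\frac{m\,\partial_\tau}{2\pi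 i}\Big)^{\mu}\phi\,\Big|_{z=0}\quad\text{if $k$ is even},$$ $$\mathcal D_{2\nu+1}(\phi)=\sum_{0\le\mu\le\nu}\frac{(-1)^\mu(2\nu+1)!\,(k+2\nu-\mu-1)!}{\mu!\,(2\nu+1-2\mu)!\,(k+\nu-1)!}\Big(\frac{\partial_z}{2\pi i}\Big)^{2\nu+1-2\mu}\Big(\frac{m\,\partial_\tau}{2\pi i}\Big)^{\mu}\phi\,\Big|_{z=0}\quad\text{if $k$ is odd},$$ and $\mathcal D_\nu(\phi)=0$ if $k$ and $\nu$ have different parity; a quotient of factorials $(x+j)!/x!$ with $j\ge0$ is read as $(x+1)\cdots(x+j)$. Then the summands of $\phi|_{k,L}V_l$ (if $\phi|_{k,L}\gamma=\phi$ for all $\gamma\in\Gamma$) and of $f|T_l$ do not depend on the choice of representatives, and the following holds. (1) For all $s\in\mathrm{Mat}_{N,N'}(\mathbb Z)$ and all $\phi:\mathbb H\times\mathbb C^N\to\mathbb C$ (for a fixed choice of representatives, if $\phi$ is not $\Gamma$-invariant), $$\phi[s]\big|_{k,L[s]}V_l=\big(\phi\big|_{k,L}V_l\big)[s],$$ and $\phi[s]\in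 J_{k,L[s]}$ if $\phi\in J_{k,L}$. (2) $V_l$ maps $J_{k,L}$ to $J_{k,lL}$, and $T_l$ maps $M_\kappa$ to $M_\kappa$ for every $\kappa\in\mathbb Z$. For all $s\in\mathbb Z^N$, $\nu\ge0$ and $\phi\in J_{k,L}$, the functions $\mathcal D_\nu(\phi[s])$ and $\mathcal D_\nu\big((\phi|_{k,L}V_l)[s]\big)$ lie in $M_{k+\nu}$ (here $\phi[s]$ has index $L[s]$ and $(\phi|_{k,L}V_l)[s]$ has index $lL[s]$), and $$\mathcal D_\nu\big((\phi|_{k,L}V_l)[s]\big)=\mathcal D_\nu(\phi[s])\,\big|\,T_l.$$ -/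

import Mathlib

open UpperHalfPlane Matrix
open scoped MatrixGroups ModularForm

noncomputable section

namespace JacobiHecke

/-- `e(x) = exp(2πi x)`. -/
def e (x : ℂ) : ℂ := Complex.exp (2 * Real.pi * Complex.I * x)

/-- A Jacobi index: a symmetric integral matrix with even diagonal entries. -/
structure IsJacobiIndex {N : ℕ} (L : Matrix (Fin N) (Fin N) ℤ) : Prop where
  symm : L.IsSymm
  even_diag : ∀ i, Even (L i i)

/-- The index `L[s] = sᵗ L s`. -/
def indexPullback {N N' : ℕ} (L : Matrix (Fin N) (Fin N) ℤ) (s : Matrix (Fin N) (Fin N') ℤ) :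
    Matrix (Fin N') (Fin N') ℤ :=
  sᵀ * L * s

/-- The bilinear form `zᵗ L w` on `ℂ^N`. -/
def bil {N : ℕ} (L : Matrix (Fin N) (Fin N) ℤ) (z w : Fin N → ℂ) : ℂ :=
  z ⬝ᵥ (L.map (Int.cast : ℤ → ℂ) *ᵥ w)

/-- The value `L[z] = zᵗ L z` for `z ∈ ℂ^N`. -/
def quad {N : ℕ} (L : Matrix (Fin N) (Fin N) ℤ) (z : Fin N → ℂ) : ℂ := bil L z z

/-- The factor `c τ + d` of an integral `2 × 2` matrix. -/
def autFactor (M : Matrix (Fin 2) (Fin 2) ℤ) (τ : ℍ) : ℂ := (M 1 0 : ℂ) * τ + (M 1 1 : ℂ)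

/-- The point `(a τ + b) / (c τ + d)`; it is only used for matrices of positive determinant, for
which the quotient has positive imaginary part, so that `ofComplex` is the identity on it. -/
def moebius (M : Matrix (Fin 2) (Fin 2) ℤ) (τ : ℍ) : ℍ :=
  ofComplex (((M 0 0 : ℂ) * τ + (M 0 1 : ℂ)) / autFactor M τ)

/-- The weight `k`, index `L` action of `(γ, (lam, mu)) ∈ SL₂(ℤ) ⋉ (ℤ^N × ℤ^N)` on functions
on `ℍ × ℂ^N`. -/
def jacobiSlash {N : ℕ} (k : ℤ) (L : Matrix (Fin N) (Fin N) ℤ) (γ : SL(2, ℤ))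
    (lam mu : Fin N → ℤ) (φ : ℍ → (Fin N → ℂ) → ℂ) (τ : ℍ) (z : Fin N → ℂ) : ℂ :=
  let lamC : Fin N → ℂ := fun i => (lam i : ℂ)
  let w : Fin N → ℂ := fun i => z i + (lam i : ℂ) * τ + (mu i : ℂ)
  autFactor γ.1 τ ^ (-k) *
    e (-((γ.1 1 0 : ℤ) : ℂ) * quad L w / (2 * autFactor γ.1 τ)
        + τ * quad L lamC / 2 + bil L lamC z) *
    φ (moebius γ.1 τ) (fun i => w i / autFactor γ.1 τ)

/-- Jacobi forms of weight `k` and index `L`: holomorphic functions on `ℍ × ℂ^N` that are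
invariant under the full Jacobi group, and such that `e(L[α] τ / 2) φ(τ, α τ + β)` stays bounded
as `Im τ → ∞` for all rational vectors `α`, `β`. -/
structure IsJacobiForm {N : ℕ} (k : ℤ) (L : Matrix (Fin N) (Fin N) ℤ)
    (φ : ℍ → (Fin N → ℂ) → ℂ) : Prop where
  holo : DifferentiableOn ℂ (fun p : ℂ × (Fin N → ℂ) => φ (ofComplex p.1) p.2)
    {p : ℂ × (Fin N → ℂ) | 0 < p.1.im}
  invariant : ∀ (γ : SL(2, ℤ)) (lam mu : Fin N → ℤ), jacobiSlash k L γ lam mu φ = φ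
  bounded : ∀ α β : Fin N → ℚ, IsBoundedAtImInfty (fun τ : ℍ =>
    e (τ * quad L (fun i => (α i : ℂ)) / 2) * φ τ (fun i => (α i : ℂ) * τ + (β i : ℂ)))

/-- The restriction `φ[s](τ, z) = φ(τ, s z)`. -/
def restrict {N N' : ℕ} (s : Matrix (Fin N) (Fin N') ℤ) (φ : ℍ → (Fin N → ℂ) → ℂ) :
    ℍ → (Fin N' → ℂ) → ℂ :=
  fun τ z => φ τ (s.map (Int.cast : ℤ → ℂ) *ᵥ z)

/-- The quotient `SL₂(ℤ) \ {M ∈ Mat₂(ℤ) : det M = l}`. -/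
abbrev HeckeCosets (l : ℕ) : Type :=
  MulAction.orbitRel.Quotient SL(2, ℤ) (FixedDetMatrix (Fin 2) ℤ (l : ℤ))

/-- The quotient is finite, so that the finite sums below are genuine. -/
theorem finite_heckeCosets (l : ℕ) (hl : 0 < l) : Finite (HeckeCosets l) := by
  have hl' : (l : ℤ) ≠ 0 := by exact_mod_cast hl.ne'
  let f : FixedDetMatrices.reps (l : ℤ) → HeckeCosets l := fun A => Quotient.mk _ A.1
  refine Finite.of_surjective f fun q => ?_
  induction q using Quotient.inductionOn with
  | h A =>
    have key : ∀ (g : SL(2, ℤ)) (B : FixedDetMatrix (Fin 2) ℤ (l : ℤ)),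
        (Quotient.mk _ (g • B) : HeckeCosets l) = Quotient.mk _ B := fun g B =>
      Quotient.sound ⟨g, rfl⟩
    refine FixedDetMatrices.induction_on (C := fun B => ∃ a, f a = Quotient.mk _ B) hl' ?_ ?_ ?_
    · intro B h1 h2 h3 h4
      exact ⟨⟨B, h1, h2, h3, h4⟩, rfl⟩
    · rintro B ⟨a, ha⟩
      exact ⟨a, ha.trans (key _ B).symm⟩
    · rintro B ⟨a, ha⟩
      exact ⟨a, ha.trans (key _ B).symm⟩

/-- The summand of `φ |_{k,L} V_l` that belongs to a matrix `M` of determinant `l`. -/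
def heckeVTerm {N : ℕ} (k : ℤ) (L : Matrix (Fin N) (Fin N) ℤ) (l : ℕ)
    (φ : ℍ → (Fin N → ℂ) → ℂ) (M : FixedDetMatrix (Fin 2) ℤ (l : ℤ)) (τ : ℍ) (z : Fin N → ℂ) :
    ℂ :=
  autFactor M.1 τ ^ (-k) *
    e (-((M.1 1 0 : ℤ) : ℂ) * ((l : ℂ) * quad L z) / (2 * autFactor M.1 τ)) *
    φ (moebius M.1 τ) (fun i => (l : ℂ) * z i / autFactor M.1 τ)

/-- The operator `V_l`: the sum over `SL₂(ℤ) \ {det = l}`, through representatives of the cosets,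
with the factor `l^(k-1)`. -/
def heckeV {N : ℕ} (k : ℤ) (L : Matrix (Fin N) (Fin N) ℤ) (l : ℕ)
    (φ : ℍ → (Fin N → ℂ) → ℂ) (τ : ℍ) (z : Fin N → ℂ) : ℂ :=
  (l : ℂ) ^ (k - 1) * ∑ᶠ q : HeckeCosets l, heckeVTerm k L l φ (Quotient.out q) τ z

/-- The summand of the classical Hecke operator `T_l` in weight `κ` that belongs to a matrix `M`
of determinant `l`. -/
def heckeTTerm (κ : ℤ) (l : ℕ) (f : ℍ → ℂ) (M : FixedDetMatrix (Fin 2) ℤ (l : ℤ)) (τ : ℍ) : ℂ :=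
  autFactor M.1 τ ^ (-κ) * f (moebius M.1 τ)

/-- The classical Hecke operator `T_l` on elliptic modular forms of weight `κ`. -/
def heckeT (κ : ℤ) (l : ℕ) (f : ℍ → ℂ) (τ : ℍ) : ℂ :=
  (l : ℂ) ^ (κ - 1) * ∑ᶠ q : HeckeCosets l, heckeTTerm κ l f (Quotient.out q) τ

/-- `(∂_z / 2πi)^a (∂_τ / 2πi)^b φ` at `z = 0`, for a function on `ℍ × ℂ`. -/
def taylorDeriv (a b : ℕ) (φ : ℍ → (Fin 1 → ℂ) → ℂ) (τ : ℍ) : ℂ :=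
  (2 * Real.pi * Complex.I)⁻¹ ^ (a + b) *
    iteratedDeriv a
      (fun z : ℂ => iteratedDeriv b (fun t : ℂ => φ (ofComplex t) (fun _ => z)) (τ : ℂ)) 0

/-- The quotient of factorials `(x + j)! / x!`, that is `(x + 1)(x + 2) ⋯ (x + j)`, for an
integer `x`. -/
def factorialQuotient (x : ℤ) (j : ℕ) : ℂ := ∏ i ∈ Finset.range j, ((x : ℂ) + 1 + (i : ℂ))

/-- The operator `𝒟_{2ν}` in weight `k` and scalar index `m`. The quotient of factorials is
`(k + 2ν - μ - 2)! / (k + ν - 2)!`. -/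
def taylorEven (k : ℤ) (m : ℂ) (ν : ℕ) (φ : ℍ → (Fin 1 → ℂ) → ℂ) (τ : ℍ) : ℂ :=
  ∑ μ ∈ Finset.range (ν + 1),
    (-1) ^ μ * ((2 * ν).factorial : ℂ) * factorialQuotient (k + ν - 2) (ν - μ) /
        ((μ.factorial : ℂ) * ((2 * ν - 2 * μ).factorial : ℂ)) *
      m ^ μ * taylorDeriv (2 * ν - 2 * μ) μ φ τ

/-- The operator `𝒟_{2ν+1}` in weight `k` and scalar index `m`. The quotient of factorials is
`(k + 2ν - μ - 1)! / (k + ν - 1)!`. -/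
def taylorOdd (k : ℤ) (m : ℂ) (ν : ℕ) (φ : ℍ → (Fin 1 → ℂ) → ℂ) (τ : ℍ) : ℂ :=
  ∑ μ ∈ Finset.range (ν + 1),
    (-1) ^ μ * ((2 * ν + 1).factorial : ℂ) * factorialQuotient (k + ν - 1) (ν - μ) /
        ((μ.factorial : ℂ) * ((2 * ν + 1 - 2 * μ).factorial : ℂ)) *
      m ^ μ * taylorDeriv (2 * ν + 1 - 2 * μ) μ φ τ

open Classical in
/-- The operator `𝒟_n` on Jacobi forms of weight `k` and rank one index `L`, which is the
scalar index `m = L / 2`; it is zero unless `k` and `n` have the same parity. -/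
def taylorOp (k : ℤ) (L : Matrix (Fin 1) (Fin 1) ℤ) (n : ℕ) (φ : ℍ → (Fin 1 → ℂ) → ℂ) :
    ℍ → ℂ :=
  if Even k ∧ Even n then taylorEven k ((L 0 0 : ℂ) / 2) (n / 2) φ
  else if Odd k ∧ Odd n then taylorOdd k ((L 0 0 : ℂ) / 2) (n / 2) φ
  else 0

end JacobiHecke

end

noncomputable section

namespace JacobiHecke

/-! Everything reduces to the action `slashMat` of one integral matrix M of positive determinant,
which turns index L into index det M · L and obeys the cocycle rule `slashMat_mul`. Up to the factor
l^(k-1), V_l is the sum of these actions over the SL₂(ℤ)-cosets. Right multiplication by SL₂(ℤ)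
permutes the cosets, hence modular invariance. A lattice translation passes through M by way of the
adjugate of M, up to an integral exponent because L is even (`heisSlash_slashMat`). Upper triangular
representatives fix the cusp, hence the growth condition. T_l is V_l in rank zero.

The diagram commutes already for a single M. By `taylorSum_slashMat`, 𝒟_n of the transform under M
is (det M)^n j^(-(k+n)) times 𝒟_n(φ) at Mτ, where j = cτ + d. For M in SL₂(ℤ) this is the modularity
of 𝒟_n(φ); summed over cosets it is compatibility with the Hecke operators, as l^(k-1) l^n =
l^(k+n-1). The proof expands the z-derivatives at 0 of the exponential factor and the τ-derivatives
of j^(-w) f(Mτ); the unwanted terms cancel by `sum_choose_mul_choose_asc`, a vanishing finite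
difference of a polynomial.

The remaining difficulty is boundedness of 𝒟_n(φ) at the cusp, since the growth condition controls φ
at each rational z separately, without uniformity. In `CuspBdd.dSnd` the maximum principle in q =
e(τ) bounds rational difference quotients on Im τ ≥ 1 by their size on the line Im τ = 1, which is
compact modulo the period, and the bound survives the limit. -/

theorem e_add (x y : ℂ) : e (x + y) = e x * e y := by
  simp only [e, mul_add, Complex.exp_add]

theorem e_zero : e 0 = 1 := by simp [e]

theorem e_intCast (n : ℤ) : e n = 1 := by
  rw [e, Complex.exp_eq_one_iff]
  exact ⟨n, by ring⟩

theorem differentiable_e : Differentiable ℂ e := by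
  unfold e
  fun_prop

/-! ### Bilinear and quadratic forms of an even integral index. -/

section Bilinear

variable {N : ℕ} (L : Matrix (Fin N) (Fin N) ℤ)

theorem bil_add_left (x y z : Fin N → ℂ) : bil L (x + y) z = bil L x z + bil L y z := by
  simp [bil, add_dotProduct]

theorem bil_add_right (x y z : Fin N → ℂ) : bil L x (y + z) = bil L x y + bil L x z := by
  simp [bil, mulVec_add]

theorem bil_smul_left (a : ℂ) (x y : Fin N → ℂ) : bil L (a • x) y = a * bil L x y := by
  simp [bil]

theorem bil_smul_right (a : ℂ) (x y : Fin N → ℂ) : bil L x (a • y) = a * bil L x y := by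
  simp [bil, mulVec_smul]

theorem quad_smul (a : ℂ) (x : Fin N → ℂ) : quad L (a • x) = a ^ 2 * quad L x := by
  simp only [quad, bil_smul_left, bil_smul_right]
  ring

theorem quad_zero : quad L 0 = 0 := by
  simp [quad, bil]

theorem bil_zero_left (x : Fin N → ℂ) : bil L 0 x = 0 := by
  simp [bil]

variable {L}

theorem bil_comm (hL : L.IsSymm) (x y : Fin N → ℂ) : bil L x y = bil L y x := by
  have h : (L.map (Int.cast : ℤ → ℂ))ᵀ = L.map (Int.cast : ℤ → ℂ) := by
    rw [← transpose_map, hL.eq]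
  rw [bil, bil, dotProduct_mulVec, dotProduct_comm, ← mulVec_transpose, h]

theorem quad_add (hL : L.IsSymm) (x y : Fin N → ℂ) :
    quad L (x + y) = quad L x + 2 * bil L x y + quad L y := by
  simp only [quad, bil_add_left, bil_add_right, bil_comm hL y x]
  ring

variable (L) in
theorem bil_zsmul (n : ℤ) (x y : Fin N → ℂ) : bil (n • L) x y = n * bil L x y := by
  have h : (n • L).map (Int.cast : ℤ → ℂ) = (n : ℂ) • L.map (Int.cast : ℤ → ℂ) := by
    ext i j
    simp only [map_apply, Matrix.smul_apply, smul_eq_mul, Int.cast_mul]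
  rw [bil, h, smul_mulVec, dotProduct_smul, smul_eq_mul, bil]

variable (L) in
theorem quad_zsmul (n : ℤ) (x : Fin N → ℂ) : quad (n • L) x = n * quad L x :=
  bil_zsmul L n x x

variable (L) in
theorem bil_intCast (x y : Fin N → ℤ) :
    bil L (fun i => (x i : ℂ)) (fun i => (y i : ℂ)) = ((x ⬝ᵥ (L *ᵥ y) : ℤ) : ℂ) := by
  simp [bil, dotProduct, mulVec]

/-- An even symmetric matrix represents only even numbers. -/
theorem even_dotProduct_mulVec (hL : IsJacobiIndex L) (x : Fin N → ℤ) :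
    Even (x ⬝ᵥ (L *ᵥ x)) := by
  rw [← ZMod.intCast_eq_zero_iff_even]
  have h : ((x ⬝ᵥ (L *ᵥ x) : ℤ) : ZMod 2) =
      ∑ p : Fin N × Fin N, (x p.1 : ZMod 2) * ((L p.1 p.2 : ZMod 2) * (x p.2 : ZMod 2)) := by
    rw [Fintype.sum_prod_type]
    simp [dotProduct, mulVec, Finset.mul_sum]
  rw [h]
  -- Modulo 2 the terms at (i, j) and (j, i) cancel by symmetry, and the diagonal terms vanish
  -- because the diagonal of L is even.
  refine Finset.sum_involution (fun p _ => p.swap) ?_ ?_ (by simp) (by simp)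
  · rintro ⟨i, j⟩ -
    have hs : L j i = L i j := hL.symm.apply i j
    simp only [Prod.swap, hs]
    rw [show (x j : ZMod 2) * ((L i j : ZMod 2) * (x i : ZMod 2)) =
      x i * ((L i j : ZMod 2) * x j) by ring]
    exact CharTwo.add_self_eq_zero _
  · rintro ⟨i, j⟩ - hne heq
    obtain rfl : j = i := congrArg Prod.fst heq
    apply hne
    simp [(ZMod.intCast_eq_zero_iff_even).2 (hL.even_diag j)]

theorem exists_quad_intCast (hL : IsJacobiIndex L) (x : Fin N → ℤ) :
    ∃ n : ℤ, quad L (fun i => (x i : ℂ)) = 2 * n := by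
  obtain ⟨n, hn⟩ := even_dotProduct_mulVec hL x
  refine ⟨n, ?_⟩
  rw [quad, bil_intCast, hn]
  push_cast
  ring

variable (L) in
theorem bil_indexPullback {N' : ℕ} (s : Matrix (Fin N) (Fin N') ℤ) (x y : Fin N' → ℂ) :
    bil (indexPullback L s) x y =
      bil L (s.map (Int.cast : ℤ → ℂ) *ᵥ x) (s.map (Int.cast : ℤ → ℂ) *ᵥ y) := by
  have h : (indexPullback L s).map (Int.cast : ℤ → ℂ) =
      (s.map (Int.cast : ℤ → ℂ))ᵀ * L.map (Int.cast : ℤ → ℂ) * s.map (Int.cast : ℤ → ℂ) := by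
    ext i j
    simp [indexPullback, mul_apply]
  rw [bil, bil, h, ← mulVec_mulVec, ← mulVec_mulVec, dotProduct_mulVec, vecMul_transpose]

variable (L) in
theorem quad_indexPullback {N' : ℕ} (s : Matrix (Fin N) (Fin N') ℤ) (x : Fin N' → ℂ) :
    quad (indexPullback L s) x = quad L (s.map (Int.cast : ℤ → ℂ) *ᵥ x) :=
  bil_indexPullback L s x x

end Bilinear

/-! ### Integral matrices of positive determinant acting on points and on functions. -/

section Moebius

variable (M M' : Matrix (Fin 2) (Fin 2) ℤ)

theorem autFactor_ne_zero (hM : 0 < M.det) (τ : ℍ) : autFactor M τ ≠ 0 := by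
  intro h
  have him := congrArg Complex.im h
  have hre := congrArg Complex.re h
  simp only [autFactor, Complex.add_im, Complex.mul_im, Complex.intCast_re, Complex.intCast_im,
    zero_mul, add_zero, Complex.zero_im, Complex.add_re, Complex.mul_re, sub_zero,
    Complex.zero_re] at him hre
  have hc : M 1 0 = 0 := by
    rcases mul_eq_zero.1 him with h | h
    · exact_mod_cast h
    · exact absurd h τ.im_pos.ne'
  have hd : M 1 1 = 0 := by
    rw [hc] at hre
    simpa using hre
  rw [det_fin_two, hc, hd] at hM
  simp at hM

theorem moebius_im_pos (hM : 0 < M.det) (τ : ℍ) :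
    0 < (((M 0 0 : ℂ) * τ + (M 0 1 : ℂ)) / autFactor M τ).im := by
  have hj := Complex.normSq_pos.2 (autFactor_ne_zero M hM τ)
  have hdet : (0 : ℝ) < M 0 0 * M 1 1 - M 0 1 * M 1 0 := by
    have := hM
    rw [det_fin_two] at this
    exact_mod_cast this
  rw [Complex.div_im, ← sub_div]
  refine div_pos ?_ hj
  simp only [autFactor, Complex.add_im, Complex.mul_im, Complex.intCast_re, Complex.intCast_im,
    zero_mul, add_zero, Complex.add_re, Complex.mul_re, sub_zero]
  have := mul_pos hdet τ.im_pos
  simp only [UpperHalfPlane.coe_re, UpperHalfPlane.coe_im] at this ⊢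
  linarith

theorem coe_moebius (hM : 0 < M.det) (τ : ℍ) :
    (moebius M τ : ℂ) = ((M 0 0 : ℂ) * τ + (M 0 1 : ℂ)) / autFactor M τ := by
  rw [moebius, ofComplex_apply_of_im_pos (moebius_im_pos M hM τ)]

theorem autFactor_mul (hM' : 0 < M'.det) (τ : ℍ) :
    autFactor (M * M') τ = autFactor M (moebius M' τ) * autFactor M' τ := by
  have hj := autFactor_ne_zero M' hM' τ
  rw [autFactor, autFactor, coe_moebius M' hM']
  field_simp
  simp only [autFactor, mul_apply, Fin.sum_univ_two]
  push_cast
  ring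

theorem moebius_mul (hM : 0 < M.det) (hM' : 0 < M'.det) (τ : ℍ) :
    moebius (M * M') τ = moebius M (moebius M' τ) := by
  have hj' := autFactor_ne_zero M' hM' τ
  have hj := autFactor_ne_zero M hM (moebius M' τ)
  have hMM : 0 < (M * M').det := by rw [det_mul]; exact mul_pos hM hM'
  apply UpperHalfPlane.ext
  rw [coe_moebius _ hMM, coe_moebius _ hM, autFactor_mul M M' hM', coe_moebius M' hM',
    ← div_div, div_right_comm]
  congr 1
  field_simp
  simp only [autFactor, mul_apply, Fin.sum_univ_two]
  push_cast
  ring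

end Moebius

/-- The action of an integral matrix of positive determinant on functions on `ℍ × ℂ^N`. -/
def slashMat {N : ℕ} (k : ℤ) (L : Matrix (Fin N) (Fin N) ℤ) (M : Matrix (Fin 2) (Fin 2) ℤ)
    (φ : ℍ → (Fin N → ℂ) → ℂ) (τ : ℍ) (z : Fin N → ℂ) : ℂ :=
  autFactor M τ ^ (-k) *
    e (-((M 1 0 : ℤ) : ℂ) * ((M.det : ℂ) * quad L z) / (2 * autFactor M τ)) *
    φ (moebius M τ) (((M.det : ℂ) / autFactor M τ) • z)

section Slash

variable {N : ℕ} (k : ℤ) (L : Matrix (Fin N) (Fin N) ℤ) (φ : ℍ → (Fin N → ℂ) → ℂ)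

theorem heckeVTerm_eq_slashMat (l : ℕ) (M : FixedDetMatrix (Fin 2) ℤ (l : ℤ)) :
    heckeVTerm k L l φ M = slashMat k L M.1 φ := by
  ext τ z
  simp only [heckeVTerm, slashMat, M.2, Int.cast_natCast]
  congr 2
  ext i
  simp only [Pi.smul_apply, smul_eq_mul]
  ring

theorem jacobiSlash_zero_eq_slashMat (γ : SL(2, ℤ)) :
    jacobiSlash k L γ 0 0 φ = slashMat k L γ.1 φ := by
  ext τ z
  have h0 : (fun _ : Fin N => (0 : ℂ)) = 0 := rfl
  simp only [jacobiSlash, slashMat, γ.2, Pi.zero_apply, Int.cast_zero, zero_mul, add_zero,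
    Int.cast_one, one_mul, h0, quad_zero, bil_zero_left, mul_zero, zero_div]
  congr 2
  ext i
  simp only [Pi.smul_apply, smul_eq_mul]
  ring

/-- The Heisenberg part of the action of the Jacobi group. -/
def heisSlash (lam mu : Fin N → ℤ) (τ : ℍ) (z : Fin N → ℂ) : ℂ :=
  e (τ * quad L (fun i => (lam i : ℂ)) / 2 + bil L (fun i => (lam i : ℂ)) z) *
    φ τ (z + ((τ : ℂ) • (fun i => (lam i : ℂ)) + fun i => (mu i : ℂ)))

theorem jacobiSlash_eq_heisSlash (γ : SL(2, ℤ)) (lam mu : Fin N → ℤ) :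
    jacobiSlash k L γ lam mu φ = heisSlash L (slashMat k L γ.1 φ) lam mu := by
  ext τ z
  have hw : (fun i => z i + (lam i : ℂ) * τ + (mu i : ℂ)) =
      z + ((τ : ℂ) • (fun i => (lam i : ℂ)) + fun i => (mu i : ℂ)) := by
    ext i
    simp only [Pi.add_apply, Pi.smul_apply, smul_eq_mul]
    ring
  simp only [jacobiSlash, heisSlash, slashMat, γ.2, hw, Int.cast_one, one_mul]
  rw [add_assoc, e_add]
  have hφ : (fun i => (z i + (lam i : ℂ) * τ + (mu i : ℂ)) / autFactor γ.1 τ) =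
      (1 / autFactor γ.1 τ) • (z + ((τ : ℂ) • (fun i => (lam i : ℂ)) + fun i => (mu i : ℂ))) := by
    rw [← hw]
    ext i
    simp only [Pi.smul_apply, smul_eq_mul]
    ring
  rw [hφ]
  ring

theorem slashMat_one : slashMat k L 1 φ = φ := by
  ext τ z
  have h1 : autFactor 1 τ = 1 := by simp [autFactor]
  have h2 : moebius 1 τ = τ := by
    apply UpperHalfPlane.ext
    rw [coe_moebius 1 (by simp), h1]
    simp
  simp [slashMat, h1, h2, e_zero]

/-- Invariance under the Jacobi group is invariance under `SL₂(ℤ)` and the Heisenberg group. -/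
theorem invariant_iff :
    (∀ (γ : SL(2, ℤ)) (lam mu : Fin N → ℤ), jacobiSlash k L γ lam mu φ = φ) ↔
      (∀ γ : SL(2, ℤ), slashMat k L γ.1 φ = φ) ∧ ∀ lam mu : Fin N → ℤ, heisSlash L φ lam mu = φ := by
  simp only [jacobiSlash_eq_heisSlash]
  refine ⟨fun h => ?_, fun h γ lam mu => by rw [h.1, h.2]⟩
  have h2 : ∀ lam mu : Fin N → ℤ, heisSlash L φ lam mu = φ := fun lam mu => by
    simpa [slashMat_one] using h 1 lam mu
  refine ⟨fun γ => ?_, h2⟩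
  simpa [← jacobiSlash_eq_heisSlash, jacobiSlash_zero_eq_slashMat] using h γ 0 0

/-- The factor det M in the dilation of z is what changes the index to det M · L. The automorphy
factors combine by `autFactor_mul`, and the exponents by the relation `key` between the lower left
entries of M, M' and M M'. -/
theorem slashMat_mul (M M' : Matrix (Fin 2) (Fin 2) ℤ) (hM : 0 < M.det) (hM' : 0 < M'.det) :
    slashMat k (M.det • L) M' (slashMat k L M φ) = slashMat k L (M * M') φ := by
  ext τ z
  have hj' := autFactor_ne_zero M' hM' τ
  have hj := autFactor_ne_zero M hM (moebius M' τ)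
  simp only [slashMat, autFactor_mul M M' hM', moebius_mul M M' hM hM', smul_smul, quad_smul,
    quad_zsmul, det_mul, mul_zpow]
  have hexp : -((M' 1 0 : ℤ) : ℂ) * ((M'.det : ℂ) * ((M.det : ℂ) * quad L z)) /
        (2 * autFactor M' τ) +
      -((M 1 0 : ℤ) : ℂ) * ((M.det : ℂ) * (((M'.det : ℂ) / autFactor M' τ) ^ 2 * quad L z)) /
        (2 * autFactor M (moebius M' τ)) =
      -(((M * M') 1 0 : ℤ) : ℂ) * (((M.det * M'.det : ℤ) : ℂ) * quad L z) /
        (2 * (autFactor M (moebius M' τ) * autFactor M' τ)) := by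
    have key : ((M' 1 0 : ℤ) : ℂ) * (autFactor M (moebius M' τ) * autFactor M' τ) +
        (M 1 0 : ℂ) * M'.det = (((M * M') 1 0 : ℤ) : ℂ) * autFactor M' τ := by
      rw [← autFactor_mul M M' hM', det_fin_two]
      simp only [autFactor, mul_apply, Fin.sum_univ_two]
      push_cast
      ring
    field_simp
    rw [Int.cast_mul]
    linear_combination (-(M'.det : ℂ) * (M.det : ℂ) * quad L z) * key
  rw [← hexp, e_add]
  have hz : (M.det : ℂ) / autFactor M (moebius M' τ) * ((M'.det : ℂ) / autFactor M' τ) =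
      ((M.det * M'.det : ℤ) : ℂ) / (autFactor M (moebius M' τ) * autFactor M' τ) := by
    rw [Int.cast_mul]
    field_simp
  rw [hz]
  ring

end Slash

/-! ### Restriction along an integral matrix s. -/

section Restrict

variable {N N' : ℕ} (k : ℤ) (L : Matrix (Fin N) (Fin N) ℤ) (s : Matrix (Fin N) (Fin N') ℤ)
  (φ : ℍ → (Fin N → ℂ) → ℂ)

theorem slashMat_restrict (M : Matrix (Fin 2) (Fin 2) ℤ) :
    slashMat k (indexPullback L s) M (restrict s φ) = restrict s (slashMat k L M φ) := by
  ext τ z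
  simp only [slashMat, restrict, quad_indexPullback, mulVec_smul]

theorem heckeV_restrict (l : ℕ) :
    heckeV k (indexPullback L s) l (restrict s φ) = restrict s (heckeV k L l φ) := by
  ext τ z
  simp only [heckeV, heckeVTerm_eq_slashMat, slashMat_restrict, restrict]

theorem map_mulVec_intCast (x : Fin N' → ℤ) :
    (s.map (Int.cast : ℤ → ℂ) *ᵥ fun i => (x i : ℂ)) = fun i => ((s *ᵥ x) i : ℂ) := by
  ext i
  simp [mulVec, dotProduct]

theorem heisSlash_restrict (lam mu : Fin N' → ℤ) :
    heisSlash (indexPullback L s) (restrict s φ) lam mu =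
      restrict s (heisSlash L φ (s *ᵥ lam) (s *ᵥ mu)) := by
  ext τ z
  simp only [heisSlash, restrict, quad_indexPullback, bil_indexPullback, map_mulVec_intCast,
    mulVec_add, mulVec_smul]

variable {k L φ}

theorem IsJacobiForm.restrict (hφ : IsJacobiForm k L φ) :
    IsJacobiForm k (indexPullback L s) (JacobiHecke.restrict s φ) where
  holo := by
    have hlin : Differentiable ℂ fun p : ℂ × (Fin N' → ℂ) =>
        (p.1, s.map (Int.cast : ℤ → ℂ) *ᵥ p.2) := by
      refine differentiable_fst.prodMk (differentiable_pi.2 fun i => ?_)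
      simp only [mulVec, dotProduct]
      fun_prop
    exact hφ.holo.comp hlin.differentiableOn fun p hp => hp
  invariant := by
    have h := (invariant_iff k L φ).1 hφ.invariant
    rw [invariant_iff]
    exact ⟨fun γ => by rw [slashMat_restrict, h.1],
      fun lam mu => by rw [heisSlash_restrict, h.2]⟩
  bounded α β := by
    have hq : ∀ x : Fin N' → ℚ, (s.map (Int.cast : ℤ → ℂ) *ᵥ fun i => (x i : ℂ)) =
        fun i => ((((s.map (Int.cast : ℤ → ℚ)) *ᵥ x) i : ℚ) : ℂ) := fun x => by
      ext i
      simp [mulVec, dotProduct]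
    have h := hφ.bounded ((s.map (Int.cast : ℤ → ℚ)) *ᵥ α) ((s.map (Int.cast : ℤ → ℚ)) *ᵥ β)
    convert h using 2 with τ
    rw [quad_indexPullback, hq]
    congr 1
    simp only [JacobiHecke.restrict]
    have hsplit : (fun i => (α i : ℂ) * τ + (β i : ℂ)) =
        (τ : ℂ) • (fun i => (α i : ℂ)) + fun i => (β i : ℂ) := by
      ext i
      simp [mul_comm]
    rw [hsplit, mulVec_add, mulVec_smul, hq, hq]
    congr 1
    ext i
    simp [mul_comm]

end Restrict

/-! ### Invariance under lattice translations. -/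

section Heisenberg

variable {N : ℕ} (k : ℤ) {L : Matrix (Fin N) (Fin N) ℤ} (φ : ℍ → (Fin N → ℂ) → ℂ)

/-- The translation by (lam, mu) after M is the translation by (lam, mu) times the adjugate of M
before M. The adjugate is integral, so invariance of φ applies at Mτ; only the exponents remain to
be compared, and modulo ℤ. -/
theorem heisSlash_slashMat (hL : IsJacobiIndex L)
    (hφ : ∀ lam mu : Fin N → ℤ, heisSlash L φ lam mu = φ) (M : Matrix (Fin 2) (Fin 2) ℤ)
    (hM : 0 < M.det) (lam mu : Fin N → ℤ) :
    heisSlash (M.det • L) (slashMat k L M φ) lam mu = slashMat k L M φ := by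
  ext τ z
  have hj := autFactor_ne_zero M hM τ
  obtain ⟨a, ha⟩ : ∃ a : ℤ, a = M 0 0 := ⟨_, rfl⟩
  obtain ⟨b, hb⟩ : ∃ b : ℤ, b = M 0 1 := ⟨_, rfl⟩
  obtain ⟨c, hc⟩ : ∃ c : ℤ, c = M 1 0 := ⟨_, rfl⟩
  obtain ⟨d, hd⟩ : ∃ d : ℤ, d = M 1 1 := ⟨_, rfl⟩
  have hdet : (M.det : ℂ) = a * d - b * c := by
    rw [det_fin_two, ← ha, ← hb, ← hc, ← hd]
    push_cast
    ring
  obtain ⟨x, hx⟩ : ∃ x : Fin N → ℂ, x = fun i => (lam i : ℂ) := ⟨_, rfl⟩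
  obtain ⟨y, hy⟩ : ∃ y : Fin N → ℂ, y = fun i => (mu i : ℂ) := ⟨_, rfl⟩
  have hlam' : (fun i => ((d • lam - c • mu) i : ℂ)) = (d : ℂ) • x + (-c : ℂ) • y := by
    ext i
    simp [hx, hy, sub_eq_add_neg]
  have hmu' : (fun i => ((-b • lam + a • mu) i : ℂ)) = (-b : ℂ) • x + (a : ℂ) • y := by
    ext i
    simp [hx, hy]
  have hinv := congrFun (congrFun (hφ (d • lam - c • mu) (-b • lam + a • mu)) (moebius M τ))
    (((M.det : ℂ) / autFactor M τ) • z)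
  obtain ⟨j, hjdef⟩ : ∃ j, j = autFactor M τ := ⟨_, rfl⟩
  have hjτ : j = c * τ + d := by rw [hjdef, autFactor, ← hc, ← hd]
  have hmob : (moebius M τ : ℂ) = (a * τ + b) / j := by rw [coe_moebius M hM, ← ha, ← hb, ← hjdef]
  rw [← hjdef] at hj
  simp only [heisSlash, hlam', hmu', hmob, ← hjdef] at hinv
  simp only [heisSlash, slashMat, ← hx, ← hy, ← hjdef, ← hc]
  have harg : ((M.det : ℂ) / j) • (z + ((τ : ℂ) • x + y)) =
      ((M.det : ℂ) / j) • z + (((a * (τ : ℂ) + b) / j) • ((d : ℂ) • x + (-c : ℂ) • y) +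
        ((-b : ℂ) • x + (a : ℂ) • y)) := by
    have h1 : (M.det : ℂ) / j * τ = (a * (τ : ℂ) + b) / j * d - b := by
      rw [hdet]
      field_simp
      rw [hjτ]
      ring
    have h2 : (M.det : ℂ) / j = (a * (τ : ℂ) + b) / j * (-c) + a := by
      rw [hdet]
      field_simp
      rw [hjτ]
      ring
    ext i
    simp only [Pi.add_apply, Pi.smul_apply, smul_eq_mul]
    linear_combination (x i) * h1 + (y i) * h2
  rw [harg, ← hinv]
  have hcomb : ∀ E₁ E₂ E₃ E₄ J P : ℂ, (∃ n : ℤ, E₁ + E₂ = E₃ + E₄ + n) →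
      e E₁ * (J * e E₂ * P) = J * e E₃ * (e E₄ * P) := by
    rintro E₁ E₂ E₃ E₄ J P ⟨n, hn⟩
    have h : e E₁ * e E₂ = e E₃ * e E₄ := by
      rw [← e_add, hn, e_add _ (n : ℂ), e_intCast, mul_one, e_add]
    linear_combination J * P * h
  apply hcomb
  simp only [quad_zsmul, bil_zsmul, quad_add hL.symm, quad_smul, bil_add_left, bil_add_right,
    bil_smul_left, bil_smul_right, bil_comm hL.symm z x, bil_comm hL.symm z y]
  obtain ⟨n₁, hn₁⟩ := exists_quad_intCast hL lam
  obtain ⟨n₂, hn₂⟩ := exists_quad_intCast hL mu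
  have hn₃ := bil_intCast L lam mu
  rw [← hx] at hn₁
  rw [← hy] at hn₂
  rw [← hx, ← hy] at hn₃
  rw [hn₁, hn₂, hn₃]
  -- The discrepancy of the exponents. Evenness of L makes it integral: n₁ and n₂ are the halves of
  -- L[lam] and L[mu].
  refine ⟨-b * d * n₁ - a * c * n₂ + b * c * (lam ⬝ᵥ L *ᵥ mu), ?_⟩
  rw [hdet]
  field_simp
  push_cast
  rw [hjτ]
  ring

end Heisenberg

/-! ### Cosets of determinant l and invariance of V_l. -/

section Cosets

variable {l : ℕ}

/-- Right multiplication by `SL₂(ℤ)` on the matrices of determinant `l`. -/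
def rightMul (M : FixedDetMatrix (Fin 2) ℤ (l : ℤ)) (γ : SL(2, ℤ)) :
    FixedDetMatrix (Fin 2) ℤ (l : ℤ) :=
  ⟨M.1 * γ.1, by rw [det_mul, M.2, γ.2, mul_one]⟩

theorem smul_rightMul (g γ : SL(2, ℤ)) (M : FixedDetMatrix (Fin 2) ℤ (l : ℤ)) :
    g • rightMul M γ = rightMul (g • M) γ :=
  FixedDetMatrices.ext' _ _ (Matrix.mul_assoc _ _ _).symm

/-- Right multiplication by `SL₂(ℤ)` on the cosets. -/
def cosetMul (γ : SL(2, ℤ)) (q : HeckeCosets l) : HeckeCosets l :=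
  Quotient.map (fun M => rightMul M γ)
    (by rintro _ B ⟨g, rfl⟩; exact ⟨g, smul_rightMul g γ B⟩) q

/-- Right multiplication by `SL₂(ℤ)` permutes the cosets. -/
def cosetEquiv (γ : SL(2, ℤ)) : HeckeCosets l ≃ HeckeCosets l where
  toFun := cosetMul γ
  invFun := cosetMul γ⁻¹
  left_inv q := by
    induction q using Quotient.inductionOn with
    | h M =>
      refine congrArg (Quotient.mk _) (FixedDetMatrices.ext' _ _ ?_)
      have h : γ.1 * (γ⁻¹).1 = 1 := congrArg (fun g : SL(2, ℤ) => g.1) (mul_inv_cancel γ)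
      change M.1 * γ.1 * (γ⁻¹).1 = M.1
      rw [Matrix.mul_assoc, h, Matrix.mul_one]
  right_inv q := by
    induction q using Quotient.inductionOn with
    | h M =>
      refine congrArg (Quotient.mk _) (FixedDetMatrices.ext' _ _ ?_)
      have h : (γ⁻¹).1 * γ.1 = 1 := congrArg (fun g : SL(2, ℤ) => g.1) (inv_mul_cancel γ)
      change M.1 * (γ⁻¹).1 * γ.1 = M.1
      rw [Matrix.mul_assoc, h, Matrix.mul_one]

/-- Needed for growth: an upper triangular matrix maps the cusp ∞ to itself. The standard
representatives are upper triangular, and the induction moves along the generators S and T. -/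
theorem exists_smul_upperTriangular (hl : 0 < l) (M : FixedDetMatrix (Fin 2) ℤ (l : ℤ)) :
    ∃ γ : SL(2, ℤ), (γ • M).1 1 0 = 0 := by
  have hl' : (l : ℤ) ≠ 0 := by exact_mod_cast hl.ne'
  refine FixedDetMatrices.induction_on
    (C := fun B => ∃ γ : SL(2, ℤ), (γ • B).1 1 0 = 0) hl' ?_ ?_ ?_
  · intro A h _ _ _
    exact ⟨1, by rwa [one_smul]⟩
  · rintro B ⟨γ, hγ⟩
    exact ⟨γ * ModularGroup.S⁻¹, by rwa [mul_smul, inv_smul_smul]⟩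
  · rintro B ⟨γ, hγ⟩
    exact ⟨γ * ModularGroup.T⁻¹, by rwa [mul_smul, inv_smul_smul]⟩

end Cosets

section Sum

variable {N : ℕ} {k : ℤ} {L : Matrix (Fin N) (Fin N) ℤ} {l : ℕ} {φ : ℍ → (Fin N → ℂ) → ℂ}

theorem slashMat_smul (hl : 0 < l) (hφ : ∀ γ : SL(2, ℤ), slashMat k L γ.1 φ = φ) (γ : SL(2, ℤ))
    (M : FixedDetMatrix (Fin 2) ℤ (l : ℤ)) :
    slashMat k L (γ • M).1 φ = slashMat k L M.1 φ := by
  have hM : 0 < M.1.det := by rw [M.2]; exact_mod_cast hl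
  rw [FixedDetMatrices.smul_coe, ← slashMat_mul k L φ γ.1 M.1 (by rw [γ.2]; exact one_pos) hM,
    hφ, γ.2, one_smul]

theorem slashMat_out (hl : 0 < l) (hφ : ∀ γ : SL(2, ℤ), slashMat k L γ.1 φ = φ)
    (M : FixedDetMatrix (Fin 2) ℤ (l : ℤ)) :
    slashMat k L (Quotient.out (Quotient.mk _ M : HeckeCosets l)).1 φ = slashMat k L M.1 φ := by
  obtain ⟨g, hg⟩ : (MulAction.orbitRel SL(2, ℤ) _).r
    (Quotient.out (Quotient.mk _ M : HeckeCosets l)) M := Quotient.mk_out M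
  rw [← hg]
  exact slashMat_smul hl hφ g M

theorem heckeV_eq_sum [Fintype (HeckeCosets l)] (τ : ℍ) (z : Fin N → ℂ) :
    heckeV k L l φ τ z =
      (l : ℂ) ^ (k - 1) * ∑ q : HeckeCosets l, slashMat k L (Quotient.out q).1 φ τ z := by
  simp only [heckeV, finsum_eq_sum_of_fintype, heckeVTerm_eq_slashMat]

/-- By the cocycle rule γ sends the summand of q to that of qγ, so it only permutes the sum. -/
theorem slashMat_heckeV (hl : 0 < l) (hφ : ∀ γ : SL(2, ℤ), slashMat k L γ.1 φ = φ)
    (γ : SL(2, ℤ)) : slashMat k ((l : ℤ) • L) γ.1 (heckeV k L l φ) = heckeV k L l φ := by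
  have := finite_heckeCosets l hl
  have := Fintype.ofFinite (HeckeCosets l)
  have hγ : 0 < γ.1.det := by rw [γ.2]; exact one_pos
  have hdet : ∀ M : FixedDetMatrix (Fin 2) ℤ (l : ℤ), 0 < M.1.det := fun M => by
    rw [M.2]; exact_mod_cast hl
  have hterm : ∀ q : HeckeCosets l,
      slashMat k ((l : ℤ) • L) γ.1 (slashMat k L (Quotient.out q).1 φ) =
        slashMat k L (Quotient.out (cosetEquiv γ q)).1 φ := fun q => by
    have h1 := slashMat_mul k L φ (Quotient.out q).1 γ.1 (hdet _) hγ
    rw [(Quotient.out q).2] at h1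
    have h2 : cosetEquiv γ q = Quotient.mk _ (rightMul (Quotient.out q) γ) := by
      conv_lhs => rw [← Quotient.out_eq q]
      rfl
    rw [h1, h2, slashMat_out hl hφ]
    rfl
  ext τ z
  rw [heckeV_eq_sum, ← (cosetEquiv γ).sum_comp]
  simp only [← hterm]
  conv_lhs => rw [slashMat]
  rw [heckeV_eq_sum]
  simp only [slashMat, Finset.mul_sum]
  exact Finset.sum_congr rfl fun q _ => by ring

theorem heisSlash_heckeV (hL : IsJacobiIndex L) (hl : 0 < l)
    (hφ : ∀ lam mu : Fin N → ℤ, heisSlash L φ lam mu = φ) (lam mu : Fin N → ℤ) :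
    heisSlash ((l : ℤ) • L) (heckeV k L l φ) lam mu = heckeV k L l φ := by
  have := finite_heckeCosets l hl
  have := Fintype.ofFinite (HeckeCosets l)
  have hterm : ∀ q : HeckeCosets l,
      heisSlash ((l : ℤ) • L) (slashMat k L (Quotient.out q).1 φ) lam mu =
        slashMat k L (Quotient.out q).1 φ := fun q => by
    have h := heisSlash_slashMat k φ hL hφ (Quotient.out q).1
      (by rw [(Quotient.out q).2]; exact_mod_cast hl) lam mu
    rwa [(Quotient.out q).2] at h
  ext τ z
  rw [heckeV_eq_sum, ← Finset.sum_congr rfl fun q _ => congrFun (congrFun (hterm q) τ) z]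
  simp only [heisSlash, heckeV_eq_sum, Finset.mul_sum]
  exact Finset.sum_congr rfl fun q _ => by ring

end Sum

/-! ### Holomorphy and growth of V_l. -/

section Holomorphy

variable {N : ℕ} {k : ℤ} {L : Matrix (Fin N) (Fin N) ℤ} {φ : ℍ → (Fin N → ℂ) → ℂ}

/-- Holomorphic functions on `ℍ × ℂ^N`. -/
def IsHolo (φ : ℍ → (Fin N → ℂ) → ℂ) : Prop :=
  DifferentiableOn ℂ (fun p : ℂ × (Fin N → ℂ) => φ (ofComplex p.1) p.2)
    {p : ℂ × (Fin N → ℂ) | 0 < p.1.im}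

theorem differentiable_quad : Differentiable ℂ (quad L) := by
  unfold quad bil dotProduct mulVec dotProduct
  fun_prop

theorem coe_ofComplex {t : ℂ} (ht : 0 < t.im) : (ofComplex t : ℂ) = t := by
  rw [ofComplex_apply_of_im_pos ht]

theorem IsHolo.slashMat (hφ : IsHolo φ) (M : Matrix (Fin 2) (Fin 2) ℤ) (hM : 0 < M.det) :
    IsHolo (slashMat k L M φ) := by
  have hU : ∀ p ∈ {p : ℂ × (Fin N → ℂ) | 0 < p.1.im}, (M 1 0 : ℂ) * p.1 + (M 1 1 : ℂ) ≠ 0 :=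
    fun p hp => by
      have := autFactor_ne_zero M hM (ofComplex p.1)
      rwa [autFactor, coe_ofComplex hp] at this
  have hden : DifferentiableOn ℂ (fun p : ℂ × (Fin N → ℂ) => (M 1 0 : ℂ) * p.1 + (M 1 1 : ℂ))
      {p : ℂ × (Fin N → ℂ) | 0 < p.1.im} := by fun_prop
  have hnum : DifferentiableOn ℂ (fun p : ℂ × (Fin N → ℂ) => (M 0 0 : ℂ) * p.1 + (M 0 1 : ℂ))
      {p : ℂ × (Fin N → ℂ) | 0 < p.1.im} := by fun_prop
  have hdiv : ∀ {f g : ℂ × (Fin N → ℂ) → ℂ} {U : Set (ℂ × (Fin N → ℂ))},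
      DifferentiableOn ℂ f U → DifferentiableOn ℂ g U → (∀ p ∈ U, g p ≠ 0) →
        DifferentiableOn ℂ (fun p => f p / g p) U := fun hf hg h0 => by
    simp only [div_eq_mul_inv]
    exact hf.mul (hg.inv h0)
  have hq : DifferentiableOn ℂ (fun p : ℂ × (Fin N → ℂ) =>
      -((M 1 0 : ℤ) : ℂ) * ((M.det : ℂ) * quad L p.2)) {p : ℂ × (Fin N → ℂ) | 0 < p.1.im} :=
    (((differentiable_quad.comp differentiable_snd).const_mul _).const_mul _).differentiableOn
  have hmap : DifferentiableOn ℂ (fun p : ℂ × (Fin N → ℂ) =>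
      (((M 0 0 : ℂ) * p.1 + (M 0 1 : ℂ)) / ((M 1 0 : ℂ) * p.1 + (M 1 1 : ℂ)),
        ((M.det : ℂ) / ((M 1 0 : ℂ) * p.1 + (M 1 1 : ℂ))) • p.2))
      {p : ℂ × (Fin N → ℂ) | 0 < p.1.im} :=
    (hdiv hnum hden hU).prodMk ((hdiv (differentiableOn_const _) hden hU).smul
      differentiable_snd.differentiableOn)
  have hcomp := DifferentiableOn.comp hφ hmap fun p hp => by
    have := moebius_im_pos M hM (ofComplex p.1)
    rwa [autFactor, coe_ofComplex hp] at this
  have hexp := differentiable_e.comp_differentiableOn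
    (hdiv hq (hden.const_mul 2) fun p hp => mul_ne_zero two_ne_zero (hU p hp))
  refine (((hden.zpow (m := -k) (Or.inl hU)).mul hexp).mul hcomp).congr
    fun p hp => ?_
  simp only [JacobiHecke.slashMat, autFactor, moebius, coe_ofComplex hp, Pi.mul_apply,
    Function.comp_apply]

theorem IsHolo.heckeV {l : ℕ} (hl : 0 < l) (hφ : IsHolo φ) : IsHolo (heckeV k L l φ) := by
  have := finite_heckeCosets l hl
  have := Fintype.ofFinite (HeckeCosets l)
  unfold IsHolo
  simp only [heckeV_eq_sum]
  refine DifferentiableOn.const_mul (DifferentiableOn.fun_sum fun q _ => ?_) _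
  exact hφ.slashMat _ (by rw [(Quotient.out q).2]; exact_mod_cast hl)

end Holomorphy

section Bounded

variable {N : ℕ} {k : ℤ} {L : Matrix (Fin N) (Fin N) ℤ} {φ : ℍ → (Fin N → ℂ) → ℂ}

theorem tendsto_moebius_atImInfty (M : Matrix (Fin 2) (Fin 2) ℤ) (hM : 0 < M.det)
    (hc : M 1 0 = 0) : Filter.Tendsto (moebius M) atImInfty atImInfty := by
  have hdet : M.det = M 0 0 * M 1 1 := by rw [det_fin_two, hc]; ring
  have hd : M 1 1 ≠ 0 := fun h => by rw [hdet, h] at hM; simp at hM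
  have hdR : (M 1 1 : ℝ) ≠ 0 := by exact_mod_cast hd
  have hpos : (0 : ℝ) < (M 0 0 : ℝ) / M 1 1 := by
    have : (0 : ℝ) < (M 0 0 : ℝ) * M 1 1 := by rw [hdet] at hM; exact_mod_cast hM
    rw [show (M 0 0 : ℝ) / M 1 1 = (M 0 0 * M 1 1) / (M 1 1) ^ 2 by field_simp]
    positivity
  have him : ∀ τ : ℍ, (moebius M τ).im = (M 0 0 : ℝ) / M 1 1 * τ.im := fun τ => by
    rw [← UpperHalfPlane.coe_im, coe_moebius M hM, autFactor, hc, ← UpperHalfPlane.coe_im]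
    have : ((M 0 0 : ℂ) * τ + (M 0 1 : ℂ)) / (((0 : ℤ) : ℂ) * τ + (M 1 1 : ℂ)) =
        ((((M 0 0 : ℝ) / M 1 1 : ℝ)) : ℂ) * τ + (((M 0 1 : ℝ) / M 1 1 : ℝ) : ℂ) := by
      push_cast
      ring
    rw [this, Complex.add_im, Complex.im_ofReal_mul, Complex.ofReal_im, add_zero]
  rw [atImInfty, Filter.tendsto_comap_iff]
  have : UpperHalfPlane.im ∘ moebius M = fun τ => (M 0 0 : ℝ) / M 1 1 * τ.im := funext him
  rw [this]
  exact Filter.Tendsto.const_mul_atTop hpos Filter.tendsto_comap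

/-- The growth condition at infinity of Jacobi forms. -/
def IsBddAtCusp (L : Matrix (Fin N) (Fin N) ℤ) (φ : ℍ → (Fin N → ℂ) → ℂ) : Prop :=
  ∀ α β : Fin N → ℚ, IsBoundedAtImInfty (fun τ : ℍ =>
    e (τ * quad L (fun i => (α i : ℂ)) / 2) * φ τ (fun i => (α i : ℂ) * τ + (β i : ℂ)))

theorem IsBddAtCusp.slashMat (hφ : IsBddAtCusp L φ) (M : Matrix (Fin 2) (Fin 2) ℤ)
    (hM : 0 < M.det) (hc : M 1 0 = 0) : IsBddAtCusp (M.det • L) (slashMat k L M φ) := by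
  intro α β
  have hdet : M.det = M 0 0 * M 1 1 := by rw [det_fin_two, hc]; ring
  have hd : M 1 1 ≠ 0 := fun h => by rw [hdet, h] at hM; simp at hM
  have hdC : (M 1 1 : ℂ) ≠ 0 := by exact_mod_cast hd
  have hj : ∀ τ, autFactor M τ = M 1 1 := fun τ => by simp [autFactor, hc]
  -- The vectors are chosen so that d α · Mτ + (a β - b α) = a (α τ + β), the argument dilated by
  -- det M / d = a. The exponential factors then differ by e(-b d L[α] / 2), a constant in τ.
  have h := (hφ (fun i => M 1 1 * α i) (fun i => M 0 0 * β i - M 0 1 * α i)).comp_tendsto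
    (tendsto_moebius_atImInfty M hM hc)
  have h2 := h.const_mul_left ((M 1 1 : ℂ) ^ (-k) *
    e (-(M 0 1 * M 1 1 * quad L (fun i => (α i : ℂ)) / 2)))
  refine h2.congr_left fun τ => ?_
  have hτ : (moebius M τ : ℂ) = ((M 0 0 : ℂ) * τ + (M 0 1 : ℂ)) / M 1 1 := by
    rw [coe_moebius M hM, hj]
  have hα : (fun i => ((M 1 1 * α i : ℚ) : ℂ)) = (M 1 1 : ℂ) • fun i => (α i : ℂ) := by
    ext i
    simp
  simp only [Function.comp_apply, JacobiHecke.slashMat, hj, hc, hα, quad_smul, quad_zsmul, hτ,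
    Int.cast_zero, neg_zero, zero_mul, zero_div, e_zero, mul_one]
  have hz : ((M.det : ℂ) / (M 1 1 : ℂ)) • (fun i => (α i : ℂ) * (τ : ℂ) + (β i : ℂ)) =
      fun i => ((M 1 1 * α i : ℚ) : ℂ) * (((M 0 0 : ℂ) * τ + (M 0 1 : ℂ)) / M 1 1) +
        ((M 0 0 * β i - M 0 1 * α i : ℚ) : ℂ) := by
    ext i
    simp only [Pi.smul_apply, smul_eq_mul, hdet]
    push_cast
    field_simp
    ring
  rw [hz]
  have hexp : e (τ * ((M.det : ℂ) * quad L fun i => (α i : ℂ)) / 2) =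
      e (-(M 0 1 * M 1 1 * quad L (fun i => (α i : ℂ)) / 2)) *
      e (((M 0 0 : ℂ) * τ + (M 0 1 : ℂ)) / M 1 1 *
        ((M 1 1 : ℂ) ^ 2 * quad L fun i => (α i : ℂ)) / 2) := by
    rw [← e_add, hdet]
    congr 1
    push_cast
    field_simp
    ring
  rw [hexp]
  ring

theorem IsBddAtCusp.heckeV {l : ℕ} (hl : 0 < l) (hφ : IsBddAtCusp L φ)
    (hinv : ∀ γ : SL(2, ℤ), JacobiHecke.slashMat k L γ.1 φ = φ) :
    IsBddAtCusp ((l : ℤ) • L) (heckeV k L l φ) := by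
  have := finite_heckeCosets l hl
  have := Fintype.ofFinite (HeckeCosets l)
  have hterm : ∀ q : HeckeCosets l,
      IsBddAtCusp ((l : ℤ) • L) (JacobiHecke.slashMat k L (Quotient.out q).1 φ) := fun q => by
    obtain ⟨γ, hγ⟩ := exists_smul_upperTriangular hl (Quotient.out q)
    rw [← slashMat_smul hl hinv γ]
    have h := hφ.slashMat (k := k) (γ • Quotient.out q).1
      (by rw [(γ • Quotient.out q).2]; exact_mod_cast hl) hγ
    rwa [(γ • Quotient.out q).2] at h
  intro α β
  have h := (Asymptotics.IsBigO.fun_sum (s := Finset.univ)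
    fun q _ => hterm q α β).const_mul_left ((l : ℂ) ^ (k - 1))
  refine h.congr_left fun τ => ?_
  simp only [heckeV_eq_sum, Finset.mul_sum]
  exact Finset.sum_congr rfl fun q _ => by ring

end Bounded

section JacobiForms

variable {N : ℕ} {k : ℤ} {L : Matrix (Fin N) (Fin N) ℤ} {φ : ℍ → (Fin N → ℂ) → ℂ}

theorem IsJacobiForm.slashMat_eq (hφ : IsJacobiForm k L φ) (γ : SL(2, ℤ)) :
    slashMat k L γ.1 φ = φ :=
  ((invariant_iff k L φ).1 hφ.invariant).1 γ

theorem IsJacobiForm.heckeV (hL : IsJacobiIndex L) {l : ℕ} (hl : 0 < l)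
    (hφ : IsJacobiForm k L φ) : IsJacobiForm k ((l : ℤ) • L) (heckeV k L l φ) where
  holo := IsHolo.heckeV hl hφ.holo
  invariant := (invariant_iff _ _ _).2 ⟨slashMat_heckeV hl hφ.slashMat_eq,
    heisSlash_heckeV hL hl ((invariant_iff k L φ).1 hφ.invariant).2⟩
  bounded := IsBddAtCusp.heckeV hl hφ.bounded hφ.slashMat_eq

end JacobiForms

/-! ### Continuous separately holomorphic functions of two variables. -/

section TwoVariables

open Filter Topology

/-- The partial derivative in the first variable. -/
def dFst (G : ℂ → ℂ → ℂ) : ℂ → ℂ → ℂ := fun s t => deriv (fun s' => G s' t) s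

/-- The partial derivative in the second variable. -/
def dSnd (G : ℂ → ℂ → ℂ) : ℂ → ℂ → ℂ := fun s t => deriv (G s) t

/-- Continuous, separately holomorphic functions on `A × B`. -/
structure SepHolo (A B : Set ℂ) (G : ℂ → ℂ → ℂ) : Prop where
  cont : ContinuousOn (fun p : ℂ × ℂ => G p.1 p.2) (A ×ˢ B)
  left : ∀ t ∈ B, DifferentiableOn ℂ (fun s => G s t) A
  right : ∀ s ∈ A, DifferentiableOn ℂ (G s) B

variable {A B : Set ℂ} {G : ℂ → ℂ → ℂ}

theorem SepHolo.swap (h : SepHolo A B G) : SepHolo B A (fun t s => G s t) where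
  cont := h.cont.comp continuous_swap.continuousOn fun _ hp => ⟨hp.2, hp.1⟩
  left := h.right
  right := h.left

/-- Joint continuity makes the slices converge locally uniformly as t → t₀; by Weierstrass so do
their derivatives. -/
theorem SepHolo.continuousOn_dFst (hA : IsOpen A) (hB : IsOpen B) (h : SepHolo A B G) :
    ContinuousOn (fun p : ℂ × ℂ => dFst G p.1 p.2) (A ×ˢ B) := by
  rintro ⟨s₀, t₀⟩ ⟨hs₀, ht₀⟩
  have hunif : TendstoLocallyUniformlyOn (fun t s => G s t) (fun s => G s t₀) (𝓝 t₀) A := by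
    rw [tendstoLocallyUniformlyOn_iff_forall_tendsto]
    intro s hs
    rw [hA.nhdsWithin_eq hs]
    have hc : ContinuousAt (fun p : ℂ × ℂ => G p.1 p.2) (s, t₀) :=
      h.cont.continuousAt ((hA.prod hB).mem_nhds ⟨hs, ht₀⟩)
    have h1 : Tendsto (fun y : ℂ × ℂ => G y.2 t₀) (𝓝 t₀ ×ˢ 𝓝 s) (𝓝 (G s t₀)) :=
      hc.tendsto.comp (tendsto_snd.prodMk_nhds tendsto_const_nhds)
    have h2 : Tendsto (fun y : ℂ × ℂ => G y.2 y.1) (𝓝 t₀ ×ˢ 𝓝 s) (𝓝 (G s t₀)) :=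
      hc.tendsto.comp (tendsto_snd.prodMk_nhds tendsto_fst)
    rw [tendsto_uniformity_iff_dist_tendsto_zero]
    simpa using h1.dist h2
  have hderiv := hunif.deriv (by filter_upwards [hB.mem_nhds ht₀] with t ht using h.left t ht) hA
  rw [tendstoLocallyUniformlyOn_iff_forall_tendsto] at hderiv
  have hd := hderiv s₀ hs₀
  rw [hA.nhdsWithin_eq hs₀, tendsto_uniformity_iff_dist_tendsto_zero] at hd
  have hcont : ContinuousAt (deriv fun s => G s t₀) s₀ :=
    ((h.left t₀ ht₀).deriv hA).continuousOn.continuousAt (hA.mem_nhds hs₀)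
  have h1 : Tendsto (fun y : ℂ × ℂ => deriv (fun s => G s t₀) y.2) (𝓝 t₀ ×ˢ 𝓝 s₀)
      (𝓝 (deriv (fun s => G s t₀) s₀)) := hcont.tendsto.comp tendsto_snd
  have h2 : Tendsto (fun y : ℂ × ℂ => dFst G y.2 y.1) (𝓝 t₀ ×ˢ 𝓝 s₀) (𝓝 (dFst G s₀ t₀)) :=
    (tendsto_iff_of_dist hd).1 h1
  have h3 : Tendsto (fun p : ℂ × ℂ => dFst G p.1 p.2) (𝓝 (s₀, t₀)) (𝓝 (dFst G s₀ t₀)) := by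
    rw [nhds_prod_eq]
    exact h2.comp tendsto_prod_swap
  exact h3.mono_left nhdsWithin_le_nhds

/-- The mean value inequality for s ↦ G s t - s · ∂₁G(s₀, t), with continuity of ∂₁G, makes the
convergence uniform for t near t₀. As locally uniform limits of functions holomorphic in t may be
differentiated, this yields both holomorphy of ∂₁G in t and the symmetry of mixed derivatives. -/
theorem SepHolo.tendsto_slope (hA : IsOpen A) (hB : IsOpen B) (h : SepHolo A B G) {s₀ : ℂ}
    (hs₀ : s₀ ∈ A) :
    TendstoLocallyUniformlyOn (fun s t => slope (fun s' => G s' t) s₀ s) (dFst G s₀) (𝓝[≠] s₀)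
      B := by
  rw [Metric.tendstoLocallyUniformlyOn_iff]
  intro ε hε t₀ ht₀
  have hc : ContinuousAt (fun p : ℂ × ℂ => dFst G p.1 p.2) (s₀, t₀) :=
    (h.continuousOn_dFst hA hB).continuousAt ((hA.prod hB).mem_nhds ⟨hs₀, ht₀⟩)
  have hnhds : ∀ᶠ p : ℂ × ℂ in 𝓝 s₀ ×ˢ 𝓝 t₀,
      dist (dFst G p.1 p.2) (dFst G s₀ t₀) < ε / 4 ∧ p.1 ∈ A ∧ p.2 ∈ B := by
    rw [← nhds_prod_eq]
    exact (Metric.tendsto_nhds.1 hc (ε / 4) (by positivity)).and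
      ((hA.prod hB).mem_nhds ⟨hs₀, ht₀⟩)
  obtain ⟨P, hP, Q, hQ, hPQ⟩ := eventually_prod_iff.1 hnhds
  obtain ⟨δ, hδ, hball⟩ := Metric.eventually_nhds_iff_ball.1 hP
  refine ⟨{t | Q t}, mem_nhdsWithin_of_mem_nhds hQ, ?_⟩
  filter_upwards [mem_nhdsWithin_of_mem_nhds (Metric.ball_mem_nhds s₀ hδ), self_mem_nhdsWithin]
    with s hs hne t ht
  have hne' : s - s₀ ≠ 0 := sub_ne_zero.2 hne
  have hder : ∀ s ∈ Metric.ball s₀ δ, HasDerivWithinAt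
      (fun s' => G s' t - s' * dFst G s₀ t) (dFst G s t - dFst G s₀ t) (Metric.ball s₀ δ) s := by
    intro s hs
    obtain ⟨-, h2, h3⟩ := hPQ (hball s hs) ht
    have h4 : HasDerivAt (fun s' => G s' t) (dFst G s t) s :=
      ((h.left t h3).differentiableAt (hA.mem_nhds h2)).hasDerivAt
    simpa using (h4.fun_sub ((hasDerivAt_id s).mul_const (dFst G s₀ t))).hasDerivWithinAt
  have hbound : ∀ s ∈ Metric.ball s₀ δ, ‖dFst G s t - dFst G s₀ t‖ ≤ ε / 2 := by
    intro s hs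
    have h1 := (hPQ (hball s hs) ht).1
    have h2 := (hPQ (hball s₀ (Metric.mem_ball_self hδ)) ht).1
    rw [← dist_eq_norm]
    have := dist_triangle_right (dFst G s t) (dFst G s₀ t) (dFst G s₀ t₀)
    linarith
  have hmv := (convex_ball s₀ δ).norm_image_sub_le_of_norm_hasDerivWithin_le hder hbound
    (Metric.mem_ball_self hδ) hs
  rw [dist_comm, dist_eq_norm, slope_def_field]
  have heq : (G s t - G s₀ t) / (s - s₀) - dFst G s₀ t =
      ((G s t - s * dFst G s₀ t) - (G s₀ t - s₀ * dFst G s₀ t)) / (s - s₀) := by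
    field_simp
    ring
  rw [heq, norm_div]
  have hpos : 0 < ‖s - s₀‖ := norm_pos_iff.2 hne'
  calc _ ≤ ε / 2 * ‖s - s₀‖ / ‖s - s₀‖ := by gcongr
    _ = ε / 2 := by field_simp
    _ < ε := by linarith

theorem SepHolo.eventually_slope (hA : IsOpen A) (h : SepHolo A B G) {s₀ : ℂ} (hs₀ : s₀ ∈ A) :
    ∀ᶠ s in 𝓝[≠] s₀, DifferentiableOn ℂ (fun t => slope (fun s' => G s' t) s₀ s) B := by
  filter_upwards [mem_nhdsWithin_of_mem_nhds (hA.mem_nhds hs₀)] with s hs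
  simp only [slope_def_field]
  exact ((h.right s hs).fun_sub (h.right s₀ hs₀)).div_const _

theorem SepHolo.dFst (hA : IsOpen A) (hB : IsOpen B) (h : SepHolo A B G) :
    SepHolo A B (dFst G) where
  cont := h.continuousOn_dFst hA hB
  left t ht := (h.left t ht).deriv hA
  right _ hs := (h.tendsto_slope hA hB hs).differentiableOn (h.eventually_slope hA hs) hB

theorem SepHolo.dSnd (hA : IsOpen A) (hB : IsOpen B) (h : SepHolo A B G) :
    SepHolo A B (dSnd G) :=
  (h.swap.dFst hB hA).swap

theorem SepHolo.dSnd_dFst (hA : IsOpen A) (hB : IsOpen B) (h : SepHolo A B G) {s t : ℂ}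
    (hs : s ∈ A) (ht : t ∈ B) :
    JacobiHecke.dSnd (JacobiHecke.dFst G) s t = JacobiHecke.dFst (JacobiHecke.dSnd G) s t := by
  have hd := ((h.tendsto_slope hA hB hs).deriv (h.eventually_slope hA hs) hB).tendsto_at ht
  refine (HasDerivAt.deriv (hasDerivAt_iff_tendsto_slope.2 (hd.congr' ?_))).symm
  filter_upwards [mem_nhdsWithin_of_mem_nhds (hA.mem_nhds hs)] with s' hs'
  have h1 := (h.right s' hs').differentiableAt (hB.mem_nhds ht)
  have h2 := (h.right s hs).differentiableAt (hB.mem_nhds ht)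
  simp only [Function.comp_apply, slope_def_field, JacobiHecke.dSnd]
  rw [deriv_div_const, deriv_fun_sub h1 h2]

theorem SepHolo.iterate_dFst (hA : IsOpen A) (hB : IsOpen B) (h : SepHolo A B G) (b : ℕ) :
    SepHolo A B (JacobiHecke.dFst^[b] G) := by
  induction b with
  | zero => exact h
  | succ b ih => rw [Function.iterate_succ_apply']; exact ih.dFst hA hB

theorem SepHolo.iterate_dSnd (hA : IsOpen A) (hB : IsOpen B) (h : SepHolo A B G) (a : ℕ) :
    SepHolo A B (JacobiHecke.dSnd^[a] G) := by
  induction a with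
  | zero => exact h
  | succ a ih => rw [Function.iterate_succ_apply']; exact ih.dSnd hA hB

theorem dFst_congr (hA : IsOpen A) {G' : ℂ → ℂ → ℂ} (h : ∀ s ∈ A, ∀ t ∈ B, G s t = G' s t)
    {s t : ℂ} (hs : s ∈ A) (ht : t ∈ B) : dFst G s t = dFst G' s t :=
  Filter.EventuallyEq.deriv_eq <| by
    filter_upwards [hA.mem_nhds hs] with s' hs' using h s' hs' t ht

theorem dSnd_congr (hB : IsOpen B) {G' : ℂ → ℂ → ℂ} (h : ∀ s ∈ A, ∀ t ∈ B, G s t = G' s t)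
    {s t : ℂ} (hs : s ∈ A) (ht : t ∈ B) : dSnd G s t = dSnd G' s t :=
  Filter.EventuallyEq.deriv_eq <| by
    filter_upwards [hB.mem_nhds ht] with t' ht' using h s hs t' ht'

theorem SepHolo.dSnd_iterate_dFst (hA : IsOpen A) (hB : IsOpen B) (h : SepHolo A B G) (b : ℕ) :
    ∀ s ∈ A, ∀ t ∈ B, JacobiHecke.dSnd (JacobiHecke.dFst^[b] G) s t =
      JacobiHecke.dFst^[b] (JacobiHecke.dSnd G) s t := by
  induction b with
  | zero => intros; rfl
  | succ b ih =>
    intro s hs t ht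
    rw [Function.iterate_succ_apply', Function.iterate_succ_apply',
      (h.iterate_dFst hA hB b).dSnd_dFst hA hB hs ht]
    exact dFst_congr hA ih hs ht

theorem SepHolo.iterate_dSnd_iterate_dFst (hA : IsOpen A) (hB : IsOpen B) (h : SepHolo A B G)
    (a b : ℕ) : ∀ s ∈ A, ∀ t ∈ B, JacobiHecke.dSnd^[a] (JacobiHecke.dFst^[b] G) s t =
      JacobiHecke.dFst^[b] (JacobiHecke.dSnd^[a] G) s t := by
  induction a with
  | zero => intros; rfl
  | succ a ih =>
    intro s hs t ht
    rw [Function.iterate_succ_apply', dSnd_congr hB ih hs ht, Function.iterate_succ_apply']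
    exact (h.iterate_dSnd hA hB a).dSnd_iterate_dFst hA hB b s hs t ht

theorem iteratedDeriv_fst (b : ℕ) (s t : ℂ) :
    iteratedDeriv b (fun s' => G s' t) s = dFst^[b] G s t := by
  induction b generalizing s with
  | zero => simp
  | succ b ih =>
    rw [iteratedDeriv_succ, Function.iterate_succ_apply', dFst]
    exact congrArg (fun f => deriv f s) (funext ih)

theorem iteratedDeriv_snd (a : ℕ) (s t : ℂ) :
    iteratedDeriv a (G s) t = dSnd^[a] G s t := by
  induction a generalizing t with
  | zero => simp
  | succ a ih =>
    rw [iteratedDeriv_succ, Function.iterate_succ_apply', dSnd]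
    exact congrArg (fun f => deriv f t) (funext ih)

end TwoVariables

/-! ### Boundedness of derivatives at the cusp. -/

section CuspBound

open Filter Topology

/-- A function is bounded on some half plane `Im s ≥ R`. -/
def BddHigh (f : ℂ → ℂ) : Prop := ∃ C R : ℝ, ∀ s : ℂ, R ≤ s.im → ‖f s‖ ≤ C

theorem BddHigh.sub {f g : ℂ → ℂ} (hf : BddHigh f) (hg : BddHigh g) :
    BddHigh (fun s => f s - g s) := by
  obtain ⟨C, R, h⟩ := hf
  obtain ⟨C', R', h'⟩ := hg
  refine ⟨C + C', max R R', fun s hs => (norm_sub_le _ _).trans ?_⟩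
  exact add_le_add (h s ((le_max_left _ _).trans hs)) (h' s ((le_max_right _ _).trans hs))

theorem isOpen_im_pos : IsOpen {s : ℂ | 0 < s.im} := isOpen_lt continuous_const Complex.continuous_im

/-- The maximum principle for periodic functions that are bounded at infinity. -/
theorem BddHigh.norm_le {f : ℂ → ℂ} (hf : BddHigh f) (hper : Function.Periodic f 1)
    (hol : DifferentiableOn ℂ f {s : ℂ | 0 < s.im}) {C : ℝ} (hC : ∀ s : ℂ, s.im = 1 → ‖f s‖ ≤ C)
    {s : ℂ} (hs : 1 ≤ s.im) : ‖f s‖ ≤ C := by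
  have hper' : Function.Periodic f ((1 : ℝ) : ℂ) := by simpa using hper
  have hdiff : ∀ s : ℂ, 0 < s.im → DifferentiableAt ℂ f s := fun s hs =>
    hol.differentiableAt (isOpen_im_pos.mem_nhds hs)
  have hbd : BoundedAtFilter (comap Complex.im atTop) f := by
    obtain ⟨B, R, h⟩ := hf
    refine Asymptotics.IsBigO.of_bound B ?_
    filter_upwards [tendsto_comap.eventually (eventually_ge_atTop R)] with s hs
    simpa using h s hs
  -- Boundedness at infinity makes q = 0 a removable singularity, so f is holomorphic in q on the
  -- whole disc.
  have h0 : DifferentiableAt ℂ (Function.Periodic.cuspFunction 1 f) 0 :=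
    Function.Periodic.differentiableAt_cuspFunction_zero one_pos hper'
      (by filter_upwards [tendsto_comap.eventually (eventually_gt_atTop 0)] with s hs
          exact hdiff s hs) hbd
  -- The circle of radius e^(-2π) is the image of the line Im s = 1 under q.
  set r : ℝ := Real.exp (-2 * Real.pi * 1 / 1) with hr
  have hr0 : 0 < r := Real.exp_pos _
  have him : ∀ q : ℂ, q ≠ 0 → ∃ s : ℂ, Function.Periodic.qParam 1 s = q := fun q hq =>
    ⟨_, Function.Periodic.qParam_right_inv one_ne_zero hq⟩
  have hcusp : ∀ q : ℂ, ‖q‖ ≤ r → DifferentiableAt ℂ (Function.Periodic.cuspFunction 1 f) q := by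
    intro q hq
    rcases eq_or_ne q 0 with rfl | hq0
    · exact h0
    · obtain ⟨s, rfl⟩ := him q hq0
      refine Function.Periodic.differentiableAt_cuspFunction one_ne_zero hper' (hdiff s ?_)
      rw [Function.Periodic.norm_qParam, hr, Real.exp_le_exp] at hq
      nlinarith [Real.pi_pos]
  have hmax := Complex.norm_le_of_forall_mem_frontier_norm_le
    (f := Function.Periodic.cuspFunction 1 f) (U := Metric.ball 0 r) Metric.isBounded_ball
    (C := C) (DifferentiableOn.diffContOnCl fun q hq => ?_) (fun q hq => ?_)
    (z := Function.Periodic.qParam 1 s) ?_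
  · rwa [Function.Periodic.eq_cuspFunction one_ne_zero hper'] at hmax
  · rw [closure_ball _ hr0.ne', mem_closedBall_zero_iff] at hq
    exact (hcusp q hq).differentiableWithinAt
  · rw [frontier_ball _ hr0.ne', mem_sphere_zero_iff_norm] at hq
    obtain ⟨s, rfl⟩ := him q (norm_pos_iff.1 (hq ▸ hr0))
    rw [Function.Periodic.eq_cuspFunction one_ne_zero hper']
    apply hC
    rw [Function.Periodic.norm_qParam, hr, Real.exp_eq_exp] at hq
    nlinarith [Real.pi_pos]
  · rw [closure_ball _ hr0.ne', mem_closedBall_zero_iff, Function.Periodic.norm_qParam, hr,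
      Real.exp_le_exp]
    nlinarith [Real.pi_pos]

/-- Holomorphic functions on `ℍ × ℂ` that are periodic in the first variable, and bounded in it
at infinity for every rational value of the second one. -/
structure CuspBdd (G : ℂ → ℂ → ℂ) : Prop where
  sepHolo : SepHolo {s : ℂ | 0 < s.im} Set.univ G
  periodic : ∀ t, Function.Periodic (fun s => G s t) 1
  bdd : ∀ x : ℚ, BddHigh fun s => G s x

variable {G : ℂ → ℂ → ℂ}

theorem CuspBdd.dFst (h : CuspBdd G) : CuspBdd (dFst G) where
  sepHolo := h.sepHolo.dFst isOpen_im_pos isOpen_univ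
  periodic t s := by
    simp only [JacobiHecke.dFst]
    rw [← deriv_comp_add_const]
    exact congrArg (fun f => deriv f s) (funext fun s' => h.periodic t s')
  bdd x := by
    obtain ⟨C, R, hC⟩ := h.bdd x
    -- Cauchy's estimate on the unit disc about s: the disc stays inside Im ≥ R, where the bound
    -- holds, and inside Im ≥ 1, where G is holomorphic.
    refine ⟨C / 1, max (R + 1) 2, fun s hs => ?_⟩
    have him : ∀ w ∈ Metric.closedBall s 1, s.im - 1 ≤ w.im := fun w hw => by
      have h1 := Complex.abs_im_le_norm (w - s)
      rw [mem_closedBall_iff_norm] at hw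
      have h2 := abs_le.1 (h1.trans hw)
      rw [Complex.sub_im] at h2
      linarith [h2.1]
    have h1 : R + 1 ≤ s.im := (le_max_left _ _).trans hs
    have h2 : 2 ≤ s.im := (le_max_right _ _).trans hs
    refine Complex.norm_deriv_le_of_forall_mem_sphere_norm_le one_pos
      (DifferentiableOn.diffContOnCl ?_) fun w hw => hC w ?_
    · refine (h.sepHolo.left _ (Set.mem_univ _)).mono fun w hw => ?_
      rw [closure_ball _ one_ne_zero] at hw
      have := him w hw
      simp only [Set.mem_ofPred_eq]
      linarith
    · linarith [him w (Metric.sphere_subset_closedBall hw)]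

/-- Pointwise bounds at rational values give no Cauchy estimate in the second variable, as nearby
values have no common bound. Instead, differences between two rational values are bounded at
infinity, so the maximum principle reduces their estimate to Im s = 1, where compactness bounds the
derivative. -/
theorem CuspBdd.dSnd (h : CuspBdd G) : CuspBdd (dSnd G) where
  sepHolo := h.sepHolo.dSnd isOpen_im_pos isOpen_univ
  periodic t s := by
    simp only [JacobiHecke.dSnd]
    exact congrArg (fun f => deriv f t) (funext fun t' => h.periodic t' s)
  bdd x := by
    have hS := h.sepHolo.dSnd isOpen_im_pos isOpen_univ
    have hper : ∀ t, Function.Periodic (fun s => JacobiHecke.dSnd G s t) 1 := fun t s => by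
      simp only [JacobiHecke.dSnd]
      exact congrArg (fun f => deriv f t) (funext fun t' => h.periodic t' s)
    have hdiff : ∀ s : ℂ, 0 < s.im → ∀ t, HasDerivAt (G s) (JacobiHecke.dSnd G s t) t :=
      fun s hs t => ((h.sepHolo.right s hs).differentiableAt univ_mem).hasDerivAt
    -- One period of the line Im s = 1, times a disc containing all the increments 1 / (n + 1) used
    -- below.
    have hK : IsCompact ((Set.Icc (0 : ℝ) 1 ×ℂ {(1 : ℝ)}) ×ˢ Metric.closedBall (x : ℂ) 1) :=
      (isCompact_Icc.reProdIm isCompact_singleton).prod (isCompact_closedBall _ _)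
    obtain ⟨B, hB⟩ := hK.exists_bound_of_continuousOn (hS.cont.mono fun p hp => by
      have : p.1.im = 1 := hp.1.2
      simp [this])
    have hB' : ∀ s : ℂ, s.im = 1 → ∀ t ∈ Metric.closedBall (x : ℂ) 1,
        ‖JacobiHecke.dSnd G s t‖ ≤ B := by
      intro s hs t ht
      have h1 := (hper t).sub_int_mul_eq (x := s) ⌊s.re⌋
      simp only [mul_one] at h1
      rw [← h1]
      refine hB (_, t) ⟨⟨?_, ?_⟩, ht⟩
      · simp only [Set.mem_preimage, Complex.sub_re, Complex.intCast_re, Set.mem_Icc]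
        constructor <;> linarith [Int.floor_le s.re, Int.lt_floor_add_one s.re]
      · simp [hs]
    refine ⟨B, 1, fun s hs => ?_⟩
    have hs0 : 0 < s.im := by linarith
    have hn : ∀ n : ℕ, ((1 / ((n : ℚ) + 1) : ℚ) : ℂ) ≠ 0 := fun n => by
      have : (1 / ((n : ℚ) + 1) : ℚ) ≠ 0 := by positivity
      exact_mod_cast this
    have hn1 : ∀ n : ℕ, ‖((1 / ((n : ℚ) + 1) : ℚ) : ℂ)‖ ≤ 1 := fun n => by
      push_cast
      rw [norm_div, norm_one]
      have : (‖(n : ℂ) + 1‖ : ℝ) = n + 1 := by exact_mod_cast Complex.norm_natCast (n + 1)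
      rw [this, div_le_one (by positivity)]
      linarith [Nat.cast_nonneg (α := ℝ) n]
    have hstep : ∀ n : ℕ, ‖G s ((x : ℂ) + ((1 / ((n : ℚ) + 1) : ℚ) : ℂ)) - G s x‖ ≤
        B * ‖((1 / ((n : ℚ) + 1) : ℚ) : ℂ)‖ := by
      intro n
      have hb := (h.bdd (x + 1 / ((n : ℚ) + 1))).sub (h.bdd x)
      rw [Rat.cast_add] at hb
      refine hb.norm_le ?_ ?_ ?_ hs
      · exact (h.periodic _).sub (h.periodic _)
      · exact (h.sepHolo.left _ (Set.mem_univ _)).fun_sub (h.sepHolo.left _ (Set.mem_univ _))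
      · intro s' hs'
        have := (convex_closedBall (x : ℂ) 1).norm_image_sub_le_of_norm_hasDerivWithin_le
          (fun t _ => (hdiff s' (by rw [hs']; exact one_pos) t).hasDerivWithinAt)
          (hB' s' hs') (Metric.mem_closedBall_self zero_le_one)
          (y := (x : ℂ) + ((1 / ((n : ℚ) + 1) : ℚ) : ℂ))
          (by rw [mem_closedBall_iff_norm, add_sub_cancel_left]; exact hn1 n)
        rwa [add_sub_cancel_left] at this
    have hlim : Tendsto (fun n : ℕ => (x : ℂ) + ((1 / ((n : ℚ) + 1) : ℚ) : ℂ)) atTop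
        (𝓝[≠] (x : ℂ)) := by
      refine tendsto_nhdsWithin_of_tendsto_nhds_of_eventually_within _ ?_
        (Eventually.of_forall fun n => by simpa using hn n)
      have := (tendsto_one_div_add_atTop_nhds_zero_nat (𝕜 := ℂ)).const_add (x : ℂ)
      simpa using this
    have hslope := ((hasDerivAt_iff_tendsto_slope.1 (hdiff s hs0 x)).comp hlim).norm
    refine le_of_tendsto hslope (Eventually.of_forall fun n => ?_)
    rw [Function.comp_apply, slope_def_field, add_sub_cancel_left, norm_div,
      div_le_iff₀ (norm_pos_iff.2 (hn n))]
    exact hstep n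

theorem CuspBdd.iterate (h : CuspBdd G) (a b : ℕ) :
    CuspBdd (JacobiHecke.dSnd^[a] (JacobiHecke.dFst^[b] G)) := by
  induction a with
  | zero =>
    induction b with
    | zero => exact h
    | succ b ih =>
      rw [Function.iterate_zero_apply] at ih ⊢
      rw [Function.iterate_succ_apply']
      exact ih.dFst
  | succ a ih => rw [Function.iterate_succ_apply']; exact ih.dSnd

end CuspBound

/-! ### Finite differences of rising factorials. -/

section Combinatorics

/-- The rising factorial `y (y + 1) ⋯ (y + j - 1)`. -/
def asc (y : ℂ) (j : ℕ) : ℂ := ∏ i ∈ Finset.range j, (y + (i : ℂ))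

@[simp]
theorem asc_zero (y : ℂ) : asc y 0 = 1 := by simp [asc]

theorem asc_add (y : ℂ) (m n : ℕ) : asc y (m + n) = asc y m * asc (y + m) n := by
  rw [asc, Finset.prod_range_add, asc, asc]
  congr 1
  refine Finset.prod_congr rfl fun i _ => ?_
  push_cast
  ring

theorem asc_one (y : ℂ) : asc y 1 = y := by simp [asc]

theorem asc_succ (y : ℂ) (n : ℕ) : asc y (n + 1) = asc y n * (y + n) := by
  rw [asc_add, asc_one]

theorem asc_succ' (y : ℂ) (n : ℕ) : asc y (n + 1) = y * asc (y + 1) n := by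
  rw [add_comm, asc_add, asc_one, Nat.cast_one]

theorem factorialQuotient_eq_asc (x : ℤ) (j : ℕ) : factorialQuotient x j = asc (x + 1) j := rfl

theorem eval_ascPochhammer_eq_asc (y : ℂ) (n : ℕ) : (ascPochhammer ℂ n).eval y = asc y n := by
  induction n with
  | zero => simp
  | succ n ih => rw [ascPochhammer_succ_eval, ih, asc_succ]

/-- A finite difference of order exceeding the degree of a rising factorial. -/
theorem sum_choose_asc_eq_zero (y : ℂ) {d n : ℕ} (hd : d < n) :
    ∑ i ∈ Finset.range (n + 1), (-1 : ℂ) ^ i * (n.choose i : ℂ) * asc (y - i) d = 0 := by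
  have hdeg : (ascPochhammer ℂ d).natDegree < n := by rwa [ascPochhammer_natDegree]
  have h := congrFun (Polynomial.fwdDiff_iter_eq_zero_of_degree_lt hdeg) (y - n)
  rw [fwdDiff_iter_eq_sum_shift, Pi.zero_apply, ← Finset.sum_range_reflect] at h
  rw [← h]
  refine Finset.sum_congr rfl fun i hi => ?_
  have hi' : i ≤ n := Nat.lt_succ_iff.1 (Finset.mem_range.1 hi)
  have h1 : n + 1 - 1 - i = n - i := by omega
  have h2 : n - (n - i) = i := by omega
  rw [h1, h2, eval_ascPochhammer_eq_asc, Nat.choose_symm hi', zsmul_eq_mul, nsmul_eq_mul,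
    Nat.cast_sub hi']
  push_cast
  congr 2
  ring

theorem sum_range_shift {ν μ : ℕ} (h : μ ≤ ν) (H : ℕ → ℂ) (h0 : ∀ p < μ, H p = 0) :
    ∑ i ∈ Finset.range (ν - μ + 1), H (μ + i) = ∑ p ∈ Finset.range (ν + 1), H p := by
  rw [show ν - μ + 1 = ν + 1 - μ by omega, ← Finset.sum_Ico_eq_sum_range, Finset.range_eq_Ico]
  refine Finset.sum_subset (Finset.Ico_subset_Ico_left (Nat.zero_le _)) fun p hp hp' => h0 p ?_
  simp only [Finset.mem_Ico] at hp hp'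
  omega

/-- Both sides are products of a run starting at K - ν - 1 and a run starting at K - p - i, with the
end points K - r - i - 2 and K - p - 1 exchanged. On the right the first factor is free of i and the
second is a polynomial in i of degree p - r - 1. -/
theorem asc_mul_asc (K : ℂ) {ν p r i : ℕ} (hp : p ≤ ν) (hr : r < p) (hi : r + i ≤ p) :
    asc (K - ν - 1) (ν - (r + i)) * asc (K - p - i) i =
      asc (K - ν - 1) (ν - p + 1) * asc (K - p - i) (p - r - 1) := by
  obtain ⟨u, rfl⟩ := Nat.exists_eq_add_of_le hp
  obtain ⟨w, rfl⟩ := Nat.exists_eq_add_of_le hi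
  rw [show r + i + w + u - (r + i) = w + u by omega, show r + i + w + u - (r + i + w) = u by omega,
    show r + i + w - r - 1 = i + w - 1 by omega]
  rcases w with _ | w
  · obtain ⟨i, rfl⟩ : ∃ q, i = q + 1 := ⟨i - 1, by omega⟩
    rw [asc_succ _ i, asc_succ _ u]
    simp only [zero_add, add_zero, Nat.add_sub_cancel]
    push_cast
    ring
  · rw [show w + 1 + u = (u + 1) + w by omega, show i + (w + 1) - 1 = i + w by omega,
      asc_add _ (u + 1) w, asc_add _ i w]
    push_cast
    ring_nf

/-- For r < p, setting μ = r + i and applying `asc_mul_asc` leaves a constant times a (p - r)-th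
difference of a polynomial of degree p - r - 1. For r ≥ p the binomials kill every term but μ = p =
r. -/
theorem sum_choose_mul_choose_asc (K : ℂ) {ν p : ℕ} (hp : p ≤ ν) (r : ℕ) :
    ∑ μ ∈ Finset.range (ν + 1), (p.choose μ : ℂ) * (μ.choose r : ℂ) * (-1) ^ μ *
        asc (K - ν - 1) (ν - μ) * asc (K - μ - p + r) (μ - r) =
      if p = r then (-1) ^ p * asc (K - ν - 1) (ν - p) else 0 := by
  rcases lt_trichotomy p r with hpr | rfl | hpr
  · rw [if_neg hpr.ne]
    refine Finset.sum_eq_zero fun μ _ => ?_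
    rcases lt_or_ge p μ with h | h
    · simp [Nat.choose_eq_zero_of_lt h]
    · simp [Nat.choose_eq_zero_of_lt (h.trans_lt hpr)]
  · rw [if_pos rfl, Finset.sum_eq_single p]
    · simp
    · intro μ _ hne
      rcases lt_or_gt_of_ne hne with h | h
      · simp [Nat.choose_eq_zero_of_lt h]
      · simp [Nat.choose_eq_zero_of_lt h]
    · intro h
      simp only [Finset.mem_range] at h
      omega
  · rw [if_neg hpr.ne']
    rw [← sum_range_shift (hpr.le.trans hp) _ fun μ hμ => by
      simp [Nat.choose_eq_zero_of_lt hμ]]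
    have hzero := sum_choose_asc_eq_zero (K - p) (d := p - r - 1) (n := p - r) (by omega)
    have hsub : Finset.range (p - r + 1) ⊆ Finset.range (ν - r + 1) := by
      intro i
      simp only [Finset.mem_range]
      omega
    rw [← Finset.sum_subset hsub fun i _ hi => by
      simp only [Finset.mem_range] at hi
      simp [Nat.choose_eq_zero_of_lt (show p < r + i by omega)]]
    rw [← mul_zero ((p.choose r : ℂ) * (-1) ^ r * asc (K - ν - 1) (ν - p + 1)), ← hzero,
      Finset.mul_sum]
    refine Finset.sum_congr rfl fun i hi => ?_
    simp only [Finset.mem_range] at hi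
    have h1 : (p.choose (r + i) : ℂ) * ((r + i).choose r : ℂ) =
        (p.choose r : ℂ) * ((p - r).choose i : ℂ) := by
      have := Nat.choose_mul (n := p) (k := r + i) (s := r) (by omega)
      rw [Nat.add_sub_cancel_left] at this
      exact_mod_cast this
    have h2 := asc_mul_asc K hp hpr (show r + i ≤ p by omega)
    have h3 : K - ((r + i : ℕ) : ℂ) - p + r = K - p - i := by
      push_cast
      ring
    rw [h1, h3, Nat.add_sub_cancel_left, pow_add]
    linear_combination ((p.choose r : ℂ) * ((p - r).choose i : ℂ) * (-1) ^ r * (-1) ^ i) * h2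

end Combinatorics

/-! ### Higher derivatives of the exponential factor and of Moebius transforms. -/

section Gaussian

/-- With E the Gaussian, E' = 2AzE; in the Leibniz rule at 0 only the first derivative of z
survives. -/
theorem iteratedDeriv_gaussian_succ_succ (A : ℂ) (n : ℕ) :
    iteratedDeriv (n + 2) (fun z : ℂ => Complex.exp (A * z ^ 2)) 0 =
      2 * A * (n + 1) * iteratedDeriv n (fun z : ℂ => Complex.exp (A * z ^ 2)) 0 := by
  have hE : ContDiff ℂ ⊤ fun z : ℂ => Complex.exp (A * z ^ 2) := by fun_prop
  have hderiv : deriv (fun z : ℂ => Complex.exp (A * z ^ 2)) =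
      fun z => (2 * A) * (z * Complex.exp (A * z ^ 2)) := by
    ext z
    have h := (((hasDerivAt_id z).pow 2).const_mul A).cexp
    refine h.deriv.trans ?_
    simp
    ring
  rw [iteratedDeriv_succ', hderiv, iteratedDeriv_const_mul_field,
    iteratedDeriv_fun_mul contDiffAt_fun_id (hE.of_le le_top).contDiffAt,
    Finset.sum_eq_single 1]
  · simp [iteratedDeriv_fun_id_zero]
    ring
  · intro i _ hi
    simp [iteratedDeriv_fun_id_zero, hi]
  · intro h
    simp at h

theorem iteratedDeriv_gaussian_even (A : ℂ) (i : ℕ) :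
    iteratedDeriv (2 * i) (fun z : ℂ => Complex.exp (A * z ^ 2)) 0 =
      ((2 * i).factorial : ℂ) / (i.factorial : ℂ) * A ^ i := by
  induction i with
  | zero => simp
  | succ i ih =>
    rw [show 2 * (i + 1) = 2 * i + 2 by ring, iteratedDeriv_gaussian_succ_succ, ih,
      Nat.factorial_succ (2 * i + 1), Nat.factorial_succ (2 * i), Nat.factorial_succ i]
    have h1 : (i.factorial : ℂ) ≠ 0 := by exact_mod_cast i.factorial_ne_zero
    have h2 : (i : ℂ) + 1 ≠ 0 := by exact_mod_cast i.succ_ne_zero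
    push_cast
    field_simp
    ring

theorem iteratedDeriv_gaussian_odd (A : ℂ) (i : ℕ) :
    iteratedDeriv (2 * i + 1) (fun z : ℂ => Complex.exp (A * z ^ 2)) 0 = 0 := by
  induction i with
  | zero =>
    have h := (((hasDerivAt_id (0 : ℂ)).pow 2).const_mul A).cexp
    rw [iteratedDeriv_one]
    exact h.deriv.trans (by simp)
  | succ i ih =>
    rw [show 2 * (i + 1) + 1 = 2 * i + 1 + 2 by ring, iteratedDeriv_gaussian_succ_succ, ih,
      mul_zero]

theorem iteratedDeriv_gaussian_mul {g : ℂ → ℂ} (hg : Differentiable ℂ g) (A B : ℂ) (a : ℕ) :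
    iteratedDeriv a (fun z : ℂ => Complex.exp (A * z ^ 2) * g (B * z)) 0 =
      ∑ i ∈ Finset.range (a / 2 + 1),
        (a.factorial : ℂ) / ((i.factorial : ℂ) * ((a - 2 * i).factorial : ℂ)) *
          (A ^ i * B ^ (a - 2 * i) * iteratedDeriv (a - 2 * i) g 0) := by
  have hE : ContDiff ℂ a fun z : ℂ => Complex.exp (A * z ^ 2) := by fun_prop
  have hgB : ContDiff ℂ a fun z : ℂ => g (B * z) :=
    (hg.comp (differentiable_id.const_mul B)).contDiff
  rw [iteratedDeriv_fun_mul hE.contDiffAt hgB.contDiffAt]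
  have hsub : (Finset.range (a / 2 + 1)).image (fun i => 2 * i) ⊆ Finset.range (a + 1) := by
    intro j
    simp only [Finset.mem_image, Finset.mem_range]
    rintro ⟨i, hi, rfl⟩
    omega
  rw [← Finset.sum_subset hsub fun j hj hj' => ?_,
    Finset.sum_image fun i _ j _ hij => by simpa using hij]
  · refine Finset.sum_congr rfl fun i hi => ?_
    simp only [Finset.mem_range] at hi
    have hle : 2 * i ≤ a := by omega
    rw [iteratedDeriv_gaussian_even, iteratedDeriv_comp_const_mul hg.contDiff,
      Nat.cast_choose ℂ hle]
    simp only [mul_zero]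
    have h1 : ((2 * i).factorial : ℂ) ≠ 0 := by exact_mod_cast (2 * i).factorial_ne_zero
    field_simp
  · simp only [Finset.mem_range, Finset.mem_image, not_exists, not_and] at hj hj'
    rcases Nat.even_or_odd' j with ⟨i, rfl | rfl⟩
    · exact absurd rfl (hj' i (by omega))
    · rw [iteratedDeriv_gaussian_odd]
      ring

end Gaussian

section MoebiusDerivatives

/-- The coefficients of the derivatives of `(c t + d)^(-w) f((a t + b) / (c t + d))`. -/
def slashCoeff (c D w : ℂ) (μ r : ℕ) : ℂ :=
  (μ.choose r : ℂ) * (-c) ^ (μ - r) * asc (w + r) (μ - r) * D ^ r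

theorem slashCoeff_succ_zero (c D w : ℂ) (μ : ℕ) :
    slashCoeff c D w (μ + 1) 0 = -(w + μ) * c * slashCoeff c D w μ 0 := by
  simp only [slashCoeff, Nat.choose_zero_right, Nat.sub_zero, asc_succ, pow_succ, Nat.cast_zero,
    add_zero, pow_zero]
  ring

theorem slashCoeff_succ_succ (c D w : ℂ) {μ r : ℕ} (hr : r ≤ μ) :
    slashCoeff c D w (μ + 1) (r + 1) =
      -(w + μ + (r + 1 : ℕ)) * c * slashCoeff c D w μ (r + 1) + D * slashCoeff c D w μ r := by
  rcases hr.eq_or_lt with rfl | hlt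
  · simp [slashCoeff, pow_succ, mul_comm]
  · obtain ⟨q, rfl⟩ := Nat.exists_eq_add_of_lt hlt
    have h1 : ((r + q + 1).choose (r + 1) : ℂ) * (r + 1) = ((r + q + 1).choose r : ℂ) * (q + 1) := by
      have := Nat.choose_succ_right_eq (r + q + 1) r
      rw [show r + q + 1 - r = q + 1 by omega] at this
      exact_mod_cast this
    simp only [slashCoeff, Nat.choose_succ_succ' (r + q + 1) r]
    rw [show r + q + 1 + 1 - (r + 1) = q + 1 by omega, show r + q + 1 - (r + 1) = q by omega,
      show r + q + 1 - r = q + 1 by omega, asc_succ, asc_succ' (w + r)]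
    have h2 : w + (r : ℂ) + 1 = w + ((r + 1 : ℕ) : ℂ) := by push_cast; ring
    rw [h2]
    generalize asc (w + ((r + 1 : ℕ) : ℂ)) q = P
    push_cast
    rw [pow_succ, pow_succ]
    linear_combination (-c) ^ q * c * P * D ^ r * D * h1

variable {a b c d : ℂ} {U : Set ℂ} {f : ℂ → ℂ}

theorem hasDerivAt_moebius {t : ℂ} (hj : c * t + d ≠ 0) :
    HasDerivAt (fun t => (a * t + b) / (c * t + d)) ((a * d - b * c) / (c * t + d) ^ 2) t := by
  have h1 : HasDerivAt (fun t : ℂ => a * t + b) a t := by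
    simpa using ((hasDerivAt_id t).const_mul a).add_const b
  have h2 : HasDerivAt (fun t : ℂ => c * t + d) c t := by
    simpa using ((hasDerivAt_id t).const_mul c).add_const d
  refine (h1.fun_div h2 hj).congr_deriv ?_
  congr 1
  ring

/-- Induction on μ: differentiating the power keeps r, differentiating the inner function raises r
and contributes the determinant. `slashCoeff` satisfies the resulting Pascal type recursion. -/
theorem iteratedDeriv_slash (hU : IsOpen U) (hf : DifferentiableOn ℂ f U)
    (hj : ∀ t ∈ U, c * t + d ≠ 0) (hmaps : ∀ t ∈ U, (a * t + b) / (c * t + d) ∈ U) (w : ℤ) (μ : ℕ) :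
    ∀ t ∈ U, iteratedDeriv μ (fun t => (c * t + d) ^ (-w) * f ((a * t + b) / (c * t + d))) t =
      ∑ r ∈ Finset.range (μ + 1), slashCoeff c (a * d - b * c) w μ r *
        ((c * t + d) ^ (-w - μ - r) * iteratedDeriv r f ((a * t + b) / (c * t + d))) := by
  induction μ with
  | zero =>
    intro t _
    simp [slashCoeff]
  | succ μ ih =>
    intro t ht
    have hj' := hj t ht
    rw [iteratedDeriv_succ, Filter.EventuallyEq.deriv_eq
      (Filter.eventuallyEq_of_mem (hU.mem_nhds ht) ih)]
    have hder : ∀ r : ℕ, HasDerivAt (iteratedDeriv r f)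
        (iteratedDeriv (r + 1) f ((a * t + b) / (c * t + d))) ((a * t + b) / (c * t + d)) := by
      intro r
      rw [iteratedDeriv_succ]
      refine DifferentiableAt.hasDerivAt ?_
      have hn := hU.mem_nhds (hmaps t ht)
      rw [iteratedDeriv_eq_iterate]
      exact ((hf.analyticAt hn).iterated_deriv r).differentiableAt
    have h2 : HasDerivAt (fun t : ℂ => c * t + d) c t := by
      simpa using ((hasDerivAt_id t).const_mul c).add_const d
    have hterm : ∀ r ∈ Finset.range (μ + 1), HasDerivAt
        (fun t => slashCoeff c (a * d - b * c) w μ r *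
          ((c * t + d) ^ (-w - μ - r) * iteratedDeriv r f ((a * t + b) / (c * t + d))))
        (slashCoeff c (a * d - b * c) w μ r *
          (-(w + μ + r) * c * ((c * t + d) ^ (-w - (μ + 1 : ℕ) - r) *
              iteratedDeriv r f ((a * t + b) / (c * t + d))) +
            (a * d - b * c) * ((c * t + d) ^ (-w - (μ + 1 : ℕ) - (r + 1 : ℕ)) *
              iteratedDeriv (r + 1) f ((a * t + b) / (c * t + d))))) t := by
      intro r _
      have hz := (hasDerivAt_zpow (-w - μ - r) (c * t + d) (Or.inl hj')).comp t h2
      have hg := (hder r).comp t (hasDerivAt_moebius (a := a) (b := b) hj')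
      refine ((hz.mul hg).const_mul _).congr_deriv ?_
      have e1 : (c * t + d) ^ (-w - μ - r - 1) = (c * t + d) ^ (-w - (μ + 1 : ℕ) - r) := by
        congr 1
        push_cast
        ring
      have e2 : (c * t + d) ^ (-w - μ - r) / (c * t + d) ^ 2 =
          (c * t + d) ^ (-w - (μ + 1 : ℕ) - (r + 1 : ℕ)) := by
        rw [← zpow_natCast (c * t + d) 2, ← zpow_sub₀ hj']
        congr 1
        push_cast
        ring
      simp only [Function.comp_apply]
      rw [e1, ← e2]
      push_cast
      ring
    rw [(HasDerivAt.fun_sum hterm).deriv]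
    set Y : ℕ → ℂ := fun r => (c * t + d) ^ (-w - (μ + 1 : ℕ) - r) *
      iteratedDeriv r f ((a * t + b) / (c * t + d)) with hY
    change ∑ r ∈ Finset.range (μ + 1), slashCoeff c (a * d - b * c) w μ r *
      (-(w + μ + r) * c * Y r + (a * d - b * c) * Y (r + 1)) =
      ∑ r ∈ Finset.range (μ + 1 + 1), slashCoeff c (a * d - b * c) w (μ + 1) r * Y r
    rw [Finset.sum_range_succ' _ (μ + 1)]
    -- Shifts r by one; the added top term vanishes because the binomial of μ over μ + 1 is zero.
    have hfirst : ∑ r ∈ Finset.range (μ + 1), slashCoeff c (a * d - b * c) w μ r *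
        (-(w + μ + r) * c * Y r) =
        ∑ r ∈ Finset.range (μ + 1), slashCoeff c (a * d - b * c) w μ (r + 1) *
          (-(w + μ + (r + 1 : ℕ)) * c * Y (r + 1)) +
        slashCoeff c (a * d - b * c) w μ 0 * (-(w + μ + (0 : ℕ)) * c * Y 0) := by
      rw [← Finset.sum_range_succ' (fun r => slashCoeff c (a * d - b * c) w μ r *
        (-(w + μ + r) * c * Y r)) (μ + 1), Finset.sum_range_succ _ (μ + 1)]
      simp [slashCoeff]
    simp only [mul_add, Finset.sum_add_distrib]
    rw [hfirst, slashCoeff_succ_zero, add_right_comm, ← Finset.sum_add_distrib]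
    congr 1
    · refine Finset.sum_congr rfl fun r hr => ?_
      rw [slashCoeff_succ_succ _ _ _ (Nat.lt_succ_iff.1 (Finset.mem_range.1 hr))]
      ring
    · push_cast
      ring

end MoebiusDerivatives

/-! ### The algebraic identity behind covariance. -/

section Algebra

/-- One term of the expanded triple sum, with p = μ + i and n = 2p + v. The right side separates a
factor that depends on μ only through p from the summand of `sum_choose_mul_choose_asc`. -/
theorem taylor_summand (k : ℤ) {μ i r u v : ℕ} (ν : ℕ) (m D c j C Q x : ℂ)
    (hQ : Q * C = D * m) (hμ : μ = r + u) :
    (-1) ^ μ * ((2 * (μ + i) + v).factorial : ℂ) *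
        asc ((k : ℂ) + (2 * (μ + i) + v : ℕ) - ν - 1) (ν - μ) /
        ((μ.factorial : ℂ) * ((2 * i + v).factorial : ℂ)) * (D * m) ^ μ * C ^ (2 * i + v + μ) *
      (((2 * i + v).factorial : ℂ) / ((i.factorial : ℂ) * (v.factorial : ℂ)) *
        ((-Q * c) ^ i * D ^ v) *
      (slashCoeff c D ((k + (2 * i + v : ℕ) - i : ℤ) : ℂ) μ r *
        (j ^ (-(k + (2 * i + v : ℕ) - i) - μ - r : ℤ) * x))) =
    ((2 * (μ + i) + v).factorial : ℂ) / (((μ + i).factorial : ℂ) * (v.factorial : ℂ)) *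
        (D * m) ^ (μ + i) * C ^ (μ + i + v) * D ^ (v + r) * (-c) ^ (μ + i - r) *
        (j ^ (-(k + (2 * (μ + i) + v : ℕ) - (μ + i : ℕ)) - r : ℤ) * x) *
      (((μ + i).choose μ : ℂ) * (μ.choose r : ℂ) * (-1) ^ μ *
        asc ((k : ℂ) + (2 * (μ + i) + v : ℕ) - ν - 1) (ν - μ) *
        asc ((k : ℂ) + (2 * (μ + i) + v : ℕ) - μ - (μ + i : ℕ) + r) (μ - r)) := by
  have hexp : (-(k + (2 * i + v : ℕ) - i) - μ - r : ℤ) =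
      -(k + (2 * (μ + i) + v : ℕ) - (μ + i : ℕ)) - r := by
    push_cast
    ring
  have hasc : ((k + (2 * i + v : ℕ) - i : ℤ) : ℂ) + r =
      (k : ℂ) + (2 * (μ + i) + v : ℕ) - μ - (μ + i : ℕ) + r := by
    push_cast
    ring
  -- Each power of the Gaussian parameter Q absorbs one normalising factor C, through Q C = D m.
  have hpow : (-Q * c) ^ i * C ^ (2 * i + v + μ) = (D * m) ^ i * (-c) ^ i * C ^ (μ + i + v) := by
    rw [show 2 * i + v + μ = i + (μ + i + v) by ring, pow_add C i, ← hQ,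
      show -Q * c = Q * (-c) by ring]
    simp only [mul_pow]
    ring
  have hchoose : ((μ + i).choose μ : ℂ) =
      ((μ + i).factorial : ℂ) / ((μ.factorial : ℂ) * (i.factorial : ℂ)) := by
    rw [Nat.cast_choose ℂ (Nat.le_add_right μ i), Nat.add_sub_cancel_left]
  have f1 : ((μ + i).factorial : ℂ) ≠ 0 := by exact_mod_cast (μ + i).factorial_ne_zero
  have f2 : ((2 * i + v).factorial : ℂ) ≠ 0 := by exact_mod_cast (2 * i + v).factorial_ne_zero
  have f3 : (μ.factorial : ℂ) ≠ 0 := by exact_mod_cast μ.factorial_ne_zero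
  have f4 : (i.factorial : ℂ) ≠ 0 := by exact_mod_cast i.factorial_ne_zero
  have f5 : (v.factorial : ℂ) ≠ 0 := by exact_mod_cast v.factorial_ne_zero
  simp only [slashCoeff]
  rw [hexp, hasc, hchoose]
  generalize asc ((k : ℂ) + (2 * (μ + i) + v : ℕ) - μ - (μ + i : ℕ) + r) (μ - r) = P
  generalize asc ((k : ℂ) + (2 * (μ + i) + v : ℕ) - ν - 1) (ν - μ) = P'
  generalize j ^ (-(k + (2 * (μ + i) + v : ℕ) - (μ + i : ℕ)) - r : ℤ) = J
  generalize ((2 * (μ + i) + v).factorial : ℂ) = F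
  have hc : (-c) ^ (μ + i - r) = (-c) ^ (μ - r) * (-c) ^ i := by
    rw [← pow_add]
    congr 1
    omega
  rw [hc]
  have hcalc : ∀ X : ℂ, X * ((-Q * c) ^ i * C ^ (2 * i + v + μ)) =
      X * ((D * m) ^ i * (-c) ^ i * C ^ (μ + i + v)) := fun X => by rw [hpow]
  field_simp
  have := hcalc (F * P' * P * J * x * (μ.choose r : ℂ) * (D * m) ^ μ * D ^ v * D ^ r *
    (-c) ^ (μ - r))
  rw [pow_add D v r, pow_add (D * m) μ i]
  linear_combination this

/-- The combinatorial core of the covariance of the Taylor development. -/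
theorem taylor_sum_identity (k : ℤ) (n : ℕ) (m D c j C Q : ℂ) (X : ℕ → ℕ → ℂ)
    (hQ : Q * C = D * m) :
    ∑ μ ∈ Finset.range (n / 2 + 1),
      (-1) ^ μ * (n.factorial : ℂ) * asc ((k : ℂ) + n - (n / 2 : ℕ) - 1) (n / 2 - μ) /
        ((μ.factorial : ℂ) * ((n - 2 * μ).factorial : ℂ)) * (D * m) ^ μ *
      (C ^ (n - 2 * μ + μ) * ∑ i ∈ Finset.range ((n - 2 * μ) / 2 + 1),
        ((n - 2 * μ).factorial : ℂ) / ((i.factorial : ℂ) * ((n - 2 * μ - 2 * i).factorial : ℂ)) *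
          ((-Q * c) ^ i * D ^ (n - 2 * μ - 2 * i)) *
        ∑ r ∈ Finset.range (μ + 1), slashCoeff c D ((k + (n - 2 * μ : ℕ) - i : ℤ) : ℂ) μ r *
          (j ^ (-(k + (n - 2 * μ : ℕ) - i) - μ - r : ℤ) * X (n - 2 * μ - 2 * i) r)) =
    D ^ n * j ^ (-(k + n)) * ∑ μ ∈ Finset.range (n / 2 + 1),
      (-1) ^ μ * (n.factorial : ℂ) * asc ((k : ℂ) + n - (n / 2 : ℕ) - 1) (n / 2 - μ) /
        ((μ.factorial : ℂ) * ((n - 2 * μ).factorial : ℂ)) * m ^ μ *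
      (C ^ (n - 2 * μ + μ) * X (n - 2 * μ) μ) := by
  set ν := n / 2 with hν
  set W : ℕ → ℕ → ℂ := fun p r => (n.factorial : ℂ) /
    ((p.factorial : ℂ) * ((n - 2 * p).factorial : ℂ)) * (D * m) ^ p * C ^ (n - p) *
    D ^ (n - 2 * p + r) * (-c) ^ (p - r) * (j ^ (-(k + n - p) - r : ℤ) * X (n - 2 * p) r) with hW
  set Z : ℕ → ℕ → ℕ → ℂ := fun p r μ => (p.choose μ : ℂ) * (μ.choose r : ℂ) * (-1) ^ μ *
    asc ((k : ℂ) + n - ν - 1) (ν - μ) * asc ((k : ℂ) + n - μ - p + r) (μ - r) with hZ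
  have hterm : ∀ μ ∈ Finset.range (ν + 1),
      (-1) ^ μ * (n.factorial : ℂ) * asc ((k : ℂ) + n - ν - 1) (ν - μ) /
        ((μ.factorial : ℂ) * ((n - 2 * μ).factorial : ℂ)) * (D * m) ^ μ *
      (C ^ (n - 2 * μ + μ) * ∑ i ∈ Finset.range ((n - 2 * μ) / 2 + 1),
        ((n - 2 * μ).factorial : ℂ) / ((i.factorial : ℂ) * ((n - 2 * μ - 2 * i).factorial : ℂ)) *
          ((-Q * c) ^ i * D ^ (n - 2 * μ - 2 * i)) *
        ∑ r ∈ Finset.range (μ + 1), slashCoeff c D ((k + (n - 2 * μ : ℕ) - i : ℤ) : ℂ) μ r *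
          (j ^ (-(k + (n - 2 * μ : ℕ) - i) - μ - r : ℤ) * X (n - 2 * μ - 2 * i) r)) =
      ∑ p ∈ Finset.range (ν + 1), ∑ r ∈ Finset.range (ν + 1), W p r * Z p r μ := by
    intro μ hμ
    have hμν : μ ≤ ν := Nat.lt_succ_iff.1 (Finset.mem_range.1 hμ)
    rw [← sum_range_shift hμν _ fun p hp => Finset.sum_eq_zero fun r _ => by
      simp [hZ, Nat.choose_eq_zero_of_lt hp], show (n - 2 * μ) / 2 = ν - μ by omega,
      ← mul_assoc, Finset.mul_sum]
    refine Finset.sum_congr rfl fun i hi => ?_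
    have hle : μ + i ≤ ν := by
      have := Finset.mem_range.1 hi
      omega
    have hsub : Finset.range (μ + 1) ⊆ Finset.range (ν + 1) := by
      intro r
      simp only [Finset.mem_range]
      omega
    rw [← Finset.sum_subset hsub fun r _ hr => by
      simp only [Finset.mem_range] at hr
      simp [hZ, Nat.choose_eq_zero_of_lt (show μ < r by omega)]]
    rw [Finset.mul_sum, Finset.mul_sum]
    refine Finset.sum_congr rfl fun r hr => ?_
    obtain ⟨u, hu⟩ := Nat.exists_eq_add_of_le (Nat.lt_succ_iff.1 (Finset.mem_range.1 hr))
    obtain ⟨v, hv⟩ := Nat.exists_eq_add_of_le (show 2 * (μ + i) ≤ n by omega)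
    have e1 : n - 2 * μ = 2 * i + v := by omega
    have e2 : 2 * i + v - 2 * i = v := by omega
    have e3 : n - 2 * (μ + i) = v := by omega
    have e4 : n - (μ + i) = μ + i + v := by omega
    have key := taylor_summand k ν m D c j C Q (X v r) hQ hu (i := i) (v := v)
    rw [← hv] at key
    simp only [hW, hZ, e1, e2, e3, e4]
    exact key
  -- Summing over μ first, for fixed p and r, makes orthogonality leave only r = p.
  rw [Finset.sum_congr rfl hterm, Finset.sum_comm, Finset.mul_sum]
  refine Finset.sum_congr rfl fun p hp => ?_
  have hpν : p ≤ ν := Nat.lt_succ_iff.1 (Finset.mem_range.1 hp)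
  rw [Finset.sum_comm]
  have hinner : ∀ r ∈ Finset.range (ν + 1), ∑ μ ∈ Finset.range (ν + 1), W p r * Z p r μ =
      W p r * if p = r then (-1) ^ p * asc ((k : ℂ) + n - ν - 1) (ν - p) else 0 := fun r _ => by
    rw [← Finset.mul_sum, hZ, sum_choose_mul_choose_asc ((k : ℂ) + n) hpν r]
  rw [Finset.sum_congr rfl hinner]
  simp only [mul_ite, mul_zero]
  rw [Finset.sum_ite_eq, if_pos hp]
  obtain ⟨v, hv⟩ := Nat.exists_eq_add_of_le (show 2 * p ≤ n by omega)
  have e1 : n - 2 * p = v := by omega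
  have e2 : n - p = v + p := by omega
  have e3 : (-(k + n - p) - p : ℤ) = -(k + n) := by ring
  have e4 : D ^ n = D ^ p * D ^ (v + p) := by
    rw [← pow_add]
    congr 1
    omega
  simp only [hW, e1, e2, e3, Nat.sub_self, pow_zero]
  rw [e4, mul_pow]
  ring

end Algebra

/-! ### Taylor coefficients in z and their covariance. -/

section Coordinates

variable {φ : ℍ → (Fin 1 → ℂ) → ℂ}

/-- A function on `ℍ × ℂ^1` as a function of two complex variables. -/
def coord (φ : ℍ → (Fin 1 → ℂ) → ℂ) : ℂ → ℂ → ℂ := fun t z => φ (ofComplex t) fun _ => z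

theorem IsHolo.sepHolo (hφ : IsHolo φ) : SepHolo {s : ℂ | 0 < s.im} Set.univ (coord φ) := by
  have hmap : Differentiable ℂ fun p : ℂ × ℂ => (p.1, fun _ : Fin 1 => p.2) :=
    differentiable_fst.prodMk (differentiable_pi.2 fun _ => differentiable_snd)
  have h : DifferentiableOn ℂ (fun p : ℂ × ℂ => coord φ p.1 p.2)
      ({s : ℂ | 0 < s.im} ×ˢ Set.univ) :=
    DifferentiableOn.comp hφ hmap.differentiableOn fun p hp => hp.1
  refine ⟨h.continuousOn, fun t _ => ?_, fun s hs => ?_⟩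
  · exact h.comp (f := fun s : ℂ => (s, t)) (by fun_prop) fun s hs => ⟨hs, Set.mem_univ _⟩
  · exact h.comp (f := fun t : ℂ => (s, t)) (by fun_prop) fun t _ => ⟨hs, Set.mem_univ _⟩

theorem taylorDeriv_eq_iterate (a b : ℕ) (τ : ℍ) :
    taylorDeriv a b φ τ =
      (2 * Real.pi * Complex.I)⁻¹ ^ (a + b) * dSnd^[a] (dFst^[b] (coord φ)) τ 0 := by
  have h : (fun z => iteratedDeriv b (fun t => coord φ t z) τ) = dFst^[b] (coord φ) τ :=
    funext fun z => iteratedDeriv_fst b τ z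
  rw [taylorDeriv, ← iteratedDeriv_snd, ← h]
  rfl

/-- The Taylor coefficients at `z = 0`, up to factorials. -/
def coeffFun (φ : ℍ → (Fin 1 → ℂ) → ℂ) (a : ℕ) : ℂ → ℂ := fun t => iteratedDeriv a (coord φ t) 0

/-- Taking the z-derivatives first allows the transformation law of the Taylor coefficients to be
differentiated in τ. -/
theorem taylorDeriv_eq_coeffFun (hφ : IsHolo φ) (a b : ℕ) (τ : ℍ) :
    taylorDeriv a b φ τ =
      (2 * Real.pi * Complex.I)⁻¹ ^ (a + b) * iteratedDeriv b (coeffFun φ a) τ := by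
  rw [taylorDeriv_eq_iterate, hφ.sepHolo.iterate_dSnd_iterate_dFst isOpen_im_pos isOpen_univ a b
    (τ : ℂ) τ.im_pos 0 (Set.mem_univ _), ← iteratedDeriv_fst]
  simp only [← iteratedDeriv_snd]
  rfl

theorem IsHolo.differentiableOn_coeffFun (hφ : IsHolo φ) (a : ℕ) :
    DifferentiableOn ℂ (coeffFun φ a) {s : ℂ | 0 < s.im} := by
  have := (hφ.sepHolo.iterate_dSnd isOpen_im_pos isOpen_univ a).left 0 (Set.mem_univ _)
  simp only [← iteratedDeriv_snd] at this
  exact this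

theorem IsHolo.differentiable_coord (hφ : IsHolo φ) {t : ℂ} (ht : 0 < t.im) :
    Differentiable ℂ (coord φ t) :=
  differentiableOn_univ.1 (hφ.sepHolo.right t ht)

theorem taylorDeriv_const_mul_sum {ι : Type*} (s : Finset ι) (c : ℂ)
    {ψ : ι → ℍ → (Fin 1 → ℂ) → ℂ} (hψ : ∀ q ∈ s, IsHolo (ψ q)) (a b : ℕ) (τ : ℍ) :
    taylorDeriv a b (fun τ z => c * ∑ q ∈ s, ψ q τ z) τ =
      c * ∑ q ∈ s, taylorDeriv a b (ψ q) τ := by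
  have hsum : IsHolo fun τ z => c * ∑ q ∈ s, ψ q τ z :=
    DifferentiableOn.const_mul (DifferentiableOn.fun_sum fun q hq => hψ q hq) c
  have hcoeff : Set.EqOn (coeffFun (fun τ z => c * ∑ q ∈ s, ψ q τ z) a)
      (fun t => c * ∑ q ∈ s, coeffFun (ψ q) a t) {s : ℂ | 0 < s.im} := by
    intro t ht
    simp only [coeffFun]
    rw [← iteratedDeriv_fun_sum fun q hq => ((hψ q hq).differentiable_coord ht).contDiff.contDiffAt,
      ← iteratedDeriv_const_mul_field]
    rfl
  rw [taylorDeriv_eq_coeffFun hsum, hcoeff.iteratedDeriv_of_isOpen isOpen_im_pos b τ.im_pos,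
    iteratedDeriv_const_mul_field, iteratedDeriv_fun_sum fun q hq =>
      (((hψ q hq).differentiableOn_coeffFun a).analyticAt
        (isOpen_im_pos.mem_nhds τ.im_pos)).contDiffAt]
  simp only [Finset.mul_sum]
  refine Finset.sum_congr rfl fun q hq => ?_
  rw [taylorDeriv_eq_coeffFun (hψ q hq)]
  ring

end Coordinates

section Covariance

variable {φ : ℍ → (Fin 1 → ℂ) → ℂ} (k : ℤ) (L : Matrix (Fin 1) (Fin 1) ℤ)

theorem quad_fin_one (z : ℂ) : quad L (fun _ => z) = L 0 0 * z ^ 2 := by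
  simp [quad, bil, dotProduct, mulVec]
  ring

theorem coord_slashMat (M : Matrix (Fin 2) (Fin 2) ℤ) {t : ℂ} (ht : 0 < t.im) (z : ℂ) :
    coord (slashMat k L M φ) t z = ((M 1 0 : ℂ) * t + (M 1 1 : ℂ)) ^ (-k) *
      (Complex.exp (-(2 * Real.pi * Complex.I * (M.det * (L 0 0 / 2))) * M 1 0 /
          ((M 1 0 : ℂ) * t + (M 1 1 : ℂ)) * z ^ 2) *
        coord φ (((M 0 0 : ℂ) * t + (M 0 1 : ℂ)) / ((M 1 0 : ℂ) * t + (M 1 1 : ℂ)))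
          (M.det / ((M 1 0 : ℂ) * t + (M 1 1 : ℂ)) * z)) := by
  simp only [coord, slashMat, moebius, autFactor, coe_ofComplex ht, quad_fin_one, e]
  rw [mul_assoc]
  congr 3
  by_cases h : (M 1 0 : ℂ) * t + (M 1 1 : ℂ) = 0
  · simp [h]
  · field_simp

theorem coeffFun_slashMat (hφ : IsHolo φ) (M : Matrix (Fin 2) (Fin 2) ℤ) (hM : 0 < M.det)
    {t : ℂ} (ht : 0 < t.im) (a : ℕ) :
    coeffFun (slashMat k L M φ) a t = ∑ i ∈ Finset.range (a / 2 + 1),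
      (a.factorial : ℂ) / ((i.factorial : ℂ) * ((a - 2 * i).factorial : ℂ)) *
        ((-(2 * Real.pi * Complex.I * (M.det * (L 0 0 / 2))) * M 1 0) ^ i *
          (M.det : ℂ) ^ (a - 2 * i)) *
      (((M 1 0 : ℂ) * t + (M 1 1 : ℂ)) ^ (-(k + a - i) : ℤ) * coeffFun φ (a - 2 * i)
        (((M 0 0 : ℂ) * t + (M 0 1 : ℂ)) / ((M 1 0 : ℂ) * t + (M 1 1 : ℂ)))) := by
  have hj : (M 1 0 : ℂ) * t + (M 1 1 : ℂ) ≠ 0 := by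
    have := autFactor_ne_zero M hM (ofComplex t)
    rwa [autFactor, coe_ofComplex ht] at this
  have him : 0 < (((M 0 0 : ℂ) * t + (M 0 1 : ℂ)) / ((M 1 0 : ℂ) * t + (M 1 1 : ℂ))).im := by
    have := moebius_im_pos M hM (ofComplex t)
    rwa [autFactor, coe_ofComplex ht] at this
  rw [coeffFun, funext (coord_slashMat k L M ht), iteratedDeriv_const_mul_field,
    iteratedDeriv_gaussian_mul (hφ.differentiable_coord him), Finset.mul_sum]
  refine Finset.sum_congr rfl fun i hi => ?_
  have hle : 2 * i ≤ a := by
    have := Finset.mem_range.1 hi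
    omega
  have hpow : ((M 1 0 : ℂ) * t + (M 1 1 : ℂ)) ^ (-(k + a - i) : ℤ) =
      ((M 1 0 : ℂ) * t + (M 1 1 : ℂ)) ^ (-k) / (((M 1 0 : ℂ) * t + (M 1 1 : ℂ)) ^ i *
        ((M 1 0 : ℂ) * t + (M 1 1 : ℂ)) ^ (a - 2 * i)) := by
    rw [← pow_add, ← zpow_natCast, ← zpow_sub₀ hj]
    congr 1
    rw [show i + (a - 2 * i) = a - i by omega, Nat.cast_sub (by omega)]
    ring
  rw [hpow, div_pow, div_pow]
  simp only [coeffFun]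
  field_simp

/-- The operators `𝒟_n` for `n` of either parity. -/
def taylorSum (k : ℤ) (m : ℂ) (n : ℕ) (φ : ℍ → (Fin 1 → ℂ) → ℂ) (τ : ℍ) : ℂ :=
  ∑ μ ∈ Finset.range (n / 2 + 1),
    (-1) ^ μ * (n.factorial : ℂ) * asc ((k : ℂ) + n - (n / 2 : ℕ) - 1) (n / 2 - μ) /
      ((μ.factorial : ℂ) * ((n - 2 * μ).factorial : ℂ)) * m ^ μ * taylorDeriv (n - 2 * μ) μ φ τ

/-- `coeffFun_slashMat` expands the Taylor coefficients and `iteratedDeriv_slash` their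
τ-derivatives; `taylor_sum_identity` collapses the result, with C = 1 / (2πi) and Q = 2πi det M · m,
where m is half the entry of L. -/
theorem taylorSum_slashMat (hφ : IsHolo φ) (M : Matrix (Fin 2) (Fin 2) ℤ) (hM : 0 < M.det)
    (n : ℕ) (τ : ℍ) :
    taylorSum k (M.det * (L 0 0 / 2)) n (slashMat k L M φ) τ =
      (M.det : ℂ) ^ n * autFactor M τ ^ (-(k + n)) *
        taylorSum k (L 0 0 / 2) n φ (moebius M τ) := by
  have hj : ∀ t ∈ {s : ℂ | 0 < s.im}, (M 1 0 : ℂ) * t + (M 1 1 : ℂ) ≠ 0 := fun t ht => by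
    have := autFactor_ne_zero M hM (ofComplex t)
    rwa [autFactor, coe_ofComplex ht] at this
  have him : ∀ t ∈ {s : ℂ | 0 < s.im}, ((M 0 0 : ℂ) * t + (M 0 1 : ℂ)) /
      ((M 1 0 : ℂ) * t + (M 1 1 : ℂ)) ∈ {s : ℂ | 0 < s.im} := fun t ht => by
    have := moebius_im_pos M hM (ofComplex t)
    rwa [autFactor, coe_ofComplex ht] at this
  have hdet : (M 0 0 : ℂ) * M 1 1 - M 0 1 * M 1 0 = M.det := by
    rw [det_fin_two]
    push_cast
    ring
  have hderiv : ∀ a b : ℕ, iteratedDeriv b (coeffFun (slashMat k L M φ) a) τ =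
      ∑ i ∈ Finset.range (a / 2 + 1),
      (a.factorial : ℂ) / ((i.factorial : ℂ) * ((a - 2 * i).factorial : ℂ)) *
        ((-(2 * Real.pi * Complex.I * (M.det * (L 0 0 / 2))) * M 1 0) ^ i *
          (M.det : ℂ) ^ (a - 2 * i)) *
      ∑ r ∈ Finset.range (b + 1), slashCoeff (M 1 0) M.det ((k + a - i : ℤ) : ℂ) b r *
        (autFactor M τ ^ (-(k + a - i) - b - r : ℤ) *
          iteratedDeriv r (coeffFun φ (a - 2 * i)) (moebius M τ)) := by
    intro a b
    have heq : Set.EqOn (coeffFun (slashMat k L M φ) a) _ {s : ℂ | 0 < s.im} :=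
      fun t ht => coeffFun_slashMat k L hφ M hM ht a
    rw [heq.iteratedDeriv_of_isOpen isOpen_im_pos b τ.im_pos, iteratedDeriv_fun_sum]
    · refine Finset.sum_congr rfl fun i _ => ?_
      rw [iteratedDeriv_const_mul_field, iteratedDeriv_slash isOpen_im_pos
        (hφ.differentiableOn_coeffFun _) hj him _ b τ τ.im_pos, hdet, coe_moebius M hM]
      rfl
    · intro i _
      refine (DifferentiableOn.analyticAt (s := {s : ℂ | 0 < s.im}) ?_
        (isOpen_im_pos.mem_nhds τ.im_pos)).contDiffAt
      refine DifferentiableOn.const_mul (DifferentiableOn.mul ?_ ?_) _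
      · exact DifferentiableOn.zpow (by fun_prop) (Or.inl hj)
      · exact (hφ.differentiableOn_coeffFun _).comp
          (DifferentiableOn.fun_div (by fun_prop) (by fun_prop) hj) him
  simp only [taylorSum, taylorDeriv_eq_coeffFun (hφ.slashMat M hM), taylorDeriv_eq_coeffFun hφ,
    hderiv]
  refine taylor_sum_identity k n (L 0 0 / 2) M.det (M 1 0) (autFactor M τ)
    (2 * Real.pi * Complex.I)⁻¹ (2 * Real.pi * Complex.I * (M.det * (L 0 0 / 2)))
    (fun a r => iteratedDeriv r (coeffFun φ a) (moebius M τ)) ?_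
  rw [mul_comm (2 * (Real.pi : ℂ) * Complex.I), mul_inv_cancel_right₀ Complex.two_pi_I_ne_zero]

end Covariance

/-! ### Modular forms and T_l as the rank zero case. -/

section ModularForms

theorem moebius_coe_SL (γ : SL(2, ℤ)) (τ : ℍ) : moebius γ.1 τ = γ • τ := by
  apply UpperHalfPlane.ext
  rw [coe_moebius _ (by rw [γ.2]; exact one_pos), coe_specialLinearGroup_apply]
  simp [autFactor]

theorem SL_slash_eq (κ : ℤ) (f : ℍ → ℂ) (γ : SL(2, ℤ)) (τ : ℍ) :
    (f ∣[κ] γ) τ = autFactor γ.1 τ ^ (-κ) * f (moebius γ.1 τ) := by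
  rw [ModularForm.SL_slash_apply, moebius_coe_SL, mul_comm]
  rfl

theorem modularForm_slash (κ : ℤ) (f : ModularForm 𝒮ℒ κ) (γ : SL(2, ℤ)) :
    (⇑f ∣[κ] γ) = f :=
  SlashInvariantForm.slash_action_eqn f _ (MonoidHom.mem_range.2 ⟨γ, rfl⟩)

theorem exists_modularForm {κ : ℤ} {f : ℍ → ℂ}
    (hol : DifferentiableOn ℂ (f ∘ ofComplex) {s : ℂ | 0 < s.im})
    (hinv : ∀ (γ : SL(2, ℤ)) (τ : ℍ), autFactor γ.1 τ ^ (-κ) * f (moebius γ.1 τ) = f τ)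
    (hbdd : IsBoundedAtImInfty f) : ∃ g : ModularForm 𝒮ℒ κ, ⇑g = f := by
  have hslash : ∀ γ : SL(2, ℤ), f ∣[κ] γ = f := fun γ => funext fun τ => by
    rw [SL_slash_eq, hinv]
  refine ⟨⟨⟨f, ?_⟩, UpperHalfPlane.mdifferentiable_iff.2 hol, fun hc => ?_⟩, rfl⟩
  · rintro _ ⟨γ, rfl⟩
    exact hslash γ
  -- All cusps are SL₂(ℤ)-translates of ∞, and f is invariant.
  · rw [OnePoint.isBoundedAt_iff_forall_SL2Z hc]
    intro γ _
    have := hslash γ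
    simp only at this ⊢
    rwa [this]

/-- Modular forms are Jacobi forms of rank zero. -/
theorem isJacobiForm_of_modularForm (κ : ℤ) (f : ModularForm 𝒮ℒ κ) :
    IsJacobiForm κ (0 : Matrix (Fin 0) (Fin 0) ℤ) fun τ _ => f τ where
  holo := by
    have h := UpperHalfPlane.mdifferentiable_iff.1 (ModularFormClass.holo f)
    exact h.comp (f := Prod.fst) differentiable_fst.differentiableOn fun p hp => hp
  invariant := by
    rw [invariant_iff]
    refine ⟨fun γ => ?_, fun lam mu => ?_⟩
    · ext τ z
      have h := congrFun (modularForm_slash κ f γ) τ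
      rw [SL_slash_eq] at h
      simpa [slashMat, quad, bil, e_zero] using h
    · ext τ z
      simp [heisSlash, quad, bil, e_zero]
  bounded α β := by
    have h : IsBoundedAtImInfty f :=
      OnePoint.isBoundedAt_infty_iff.1 (ModularFormClass.bdd_at_cusps f (Fact.out))
    simpa [quad, bil, e_zero] using h

theorem heckeTTerm_eq_heckeVTerm (κ : ℤ) (l : ℕ) (f : ℍ → ℂ)
    (M : FixedDetMatrix (Fin 2) ℤ (l : ℤ)) (τ : ℍ) (z : Fin 0 → ℂ) :
    heckeVTerm κ (0 : Matrix (Fin 0) (Fin 0) ℤ) l (fun τ _ => f τ) M τ z =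
      heckeTTerm κ l f M τ := by
  simp [heckeVTerm, heckeTTerm, quad, bil, e_zero]

theorem heckeT_eq_heckeV (κ : ℤ) (l : ℕ) (f : ℍ → ℂ) (τ : ℍ) (z : Fin 0 → ℂ) :
    heckeV κ (0 : Matrix (Fin 0) (Fin 0) ℤ) l (fun τ _ => f τ) τ z = heckeT κ l f τ := by
  simp only [heckeV, heckeT, heckeTTerm_eq_heckeVTerm]

theorem exists_modularForm_heckeT (κ : ℤ) {l : ℕ} (hl : 0 < l) (f : ModularForm 𝒮ℒ κ) :
    ∃ g : ModularForm 𝒮ℒ κ, ⇑g = heckeT κ l f := by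
  have h0 : IsJacobiIndex (0 : Matrix (Fin 0) (Fin 0) ℤ) := ⟨by simp [IsSymm], fun i => i.elim0⟩
  have hJ := (isJacobiForm_of_modularForm κ f).heckeV h0 hl
  have hV : heckeV κ (0 : Matrix (Fin 0) (Fin 0) ℤ) l (fun τ _ => f τ) =
      fun τ _ => heckeT κ l f τ := by
    ext τ z
    exact heckeT_eq_heckeV κ l f τ z
  rw [hV] at hJ
  refine exists_modularForm ?_ (fun γ τ => ?_) ?_
  · exact hJ.holo.comp (f := fun t : ℂ => (t, (0 : Fin 0 → ℂ))) (by fun_prop) fun t ht => ht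
  · have h := congrFun (congrFun (hJ.slashMat_eq γ) τ) 0
    simpa [slashMat, quad, bil, e_zero] using h
  · have h := hJ.bounded 0 0
    simpa [quad, bil, e_zero] using h

end ModularForms

/-! ### The operators 𝒟_n on Jacobi forms and their compatibility with V_l. -/

section Taylor

variable {k : ℤ} {L : Matrix (Fin 1) (Fin 1) ℤ} {φ : ℍ → (Fin 1 → ℂ) → ℂ}

theorem IsJacobiForm.cuspBdd (hφ : IsJacobiForm k L φ) : CuspBdd (coord φ) where
  sepHolo := IsHolo.sepHolo hφ.holo
  periodic t s := by
    simp only [coord]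
    rcases lt_or_ge 0 s.im with hs | hs
    · have h := congrFun (congrFun (hφ.slashMat_eq ModularGroup.T) (ofComplex s)) fun _ => t
      have hT : ModularGroup.T.1 = !![1, 1; 0, 1] := rfl
      simpa [slashMat, hT, autFactor, moebius, coe_ofComplex hs, e_zero] using h
    -- Off the upper half plane `ofComplex` takes a single default value, so periodicity holds there
    -- as well.
    · rw [ofComplex_apply_eq_of_im_nonpos (w' := s) (by simpa using hs) hs]
  bdd x := by
    obtain ⟨C, R, h⟩ := UpperHalfPlane.isBoundedAtImInfty_iff.1 (hφ.bounded 0 fun _ => x)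
    refine ⟨C, max R 1, fun s hs => ?_⟩
    have hs0 : 0 < s.im := by linarith [(le_max_right R 1).trans hs]
    have h1 := h (ofComplex s) (by
      rw [← UpperHalfPlane.coe_im, coe_ofComplex hs0]
      exact (le_max_left R 1).trans hs)
    have h0 : (fun _ : Fin 1 => (0 : ℂ)) = 0 := rfl
    simpa [h0, quad_zero, e_zero, coord] using h1

theorem IsJacobiForm.exists_taylorSum (hφ : IsJacobiForm k L φ) (n : ℕ) :
    ∃ f : ModularForm 𝒮ℒ (k + n), ⇑f = taylorSum k (L 0 0 / 2) n φ := by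
  refine exists_modularForm ?_ (fun γ τ => ?_) ?_
  · have hterm : ∀ a b : ℕ, DifferentiableOn ℂ (fun t : ℂ => taylorDeriv a b φ (ofComplex t))
        {s : ℂ | 0 < s.im} := fun a b => by
      have h := ((hφ.cuspBdd.iterate a b).sepHolo.left 0 (Set.mem_univ _)).const_mul
        ((2 * (Real.pi : ℂ) * Complex.I)⁻¹ ^ (a + b))
      refine h.congr fun t ht => ?_
      rw [taylorDeriv_eq_iterate, coe_ofComplex ht]
    simp only [Function.comp_def, taylorSum]
    exact DifferentiableOn.fun_sum fun μ _ => (hterm _ _).const_mul _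
  · have h := taylorSum_slashMat k L hφ.holo γ.1 (by rw [γ.2]; exact one_pos) n τ
    rw [hφ.slashMat_eq, γ.2] at h
    simpa using h.symm
  · have hterm : ∀ a b : ℕ, IsBoundedAtImInfty (taylorDeriv a b φ) := fun a b => by
      obtain ⟨C, R, h⟩ := (hφ.cuspBdd.iterate a b).bdd 0
      rw [UpperHalfPlane.isBoundedAtImInfty_iff]
      refine ⟨‖(2 * (Real.pi : ℂ) * Complex.I)⁻¹ ^ (a + b)‖ * C, R, fun τ hτ => ?_⟩
      rw [taylorDeriv_eq_iterate, norm_mul]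
      have := h τ hτ
      rw [Rat.cast_zero] at this
      gcongr
    exact Asymptotics.IsBigO.fun_sum fun μ _ => (hterm _ _).const_mul_left _

theorem taylorSum_heckeV (hφ : IsHolo φ) {l : ℕ} (hl : 0 < l) (n : ℕ) :
    taylorSum k (l * (L 0 0 / 2)) n (heckeV k L l φ) =
      heckeT (k + n) l (taylorSum k (L 0 0 / 2) n φ) := by
  have := finite_heckeCosets l hl
  have := Fintype.ofFinite (HeckeCosets l)
  have hdet : ∀ q : HeckeCosets l, 0 < (Quotient.out q).1.det := fun q => by
    rw [(Quotient.out q).2]; exact_mod_cast hl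
  have hl0 : (l : ℂ) ≠ 0 := by exact_mod_cast hl.ne'
  ext τ
  have hV : heckeV k L l φ = fun τ z => (l : ℂ) ^ (k - 1) *
      ∑ q : HeckeCosets l, slashMat k L (Quotient.out q).1 φ τ z := by
    ext τ z
    exact heckeV_eq_sum τ z
  have hlin : taylorSum k (l * (L 0 0 / 2)) n (heckeV k L l φ) τ = (l : ℂ) ^ (k - 1) *
      ∑ q : HeckeCosets l,
        taylorSum k (l * (L 0 0 / 2)) n (slashMat k L (Quotient.out q).1 φ) τ := by
    simp only [taylorSum]
    rw [Finset.sum_comm, Finset.mul_sum, hV]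
    refine Finset.sum_congr rfl fun μ _ => ?_
    rw [taylorDeriv_const_mul_sum _ _ fun q _ => hφ.slashMat _ (hdet q), ← Finset.mul_sum]
    ring
  rw [hlin, heckeT, finsum_eq_sum_of_fintype,
    show k + (n : ℤ) - 1 = k - 1 + n by ring, zpow_add₀ hl0, zpow_natCast, mul_assoc]
  congr 1
  rw [Finset.mul_sum]
  refine Finset.sum_congr rfl fun q _ => ?_
  have h := taylorSum_slashMat k L hφ (Quotient.out q).1 (hdet q) n τ
  rw [(Quotient.out q).2, Int.cast_natCast] at h
  rw [h, heckeTTerm, mul_assoc]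

/-- With ν = ⌊n/2⌋, the rising factorials in both parities start at k + n - ν - 1, so one formula
covers them. -/
theorem taylorOp_eq (k : ℤ) (L : Matrix (Fin 1) (Fin 1) ℤ) (n : ℕ) (φ : ℍ → (Fin 1 → ℂ) → ℂ) :
    taylorOp k L n φ = if (Even k ↔ Even n) then taylorSum k (L 0 0 / 2) n φ else 0 := by
  have heven : Even n → taylorEven k (L 0 0 / 2) (n / 2) φ = taylorSum k (L 0 0 / 2) n φ := by
    rintro ⟨ν, rfl⟩
    ext τ
    rw [← two_mul, Nat.mul_div_cancel_left ν two_pos]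
    simp only [taylorEven, taylorSum, factorialQuotient_eq_asc,
      Nat.mul_div_cancel_left ν two_pos]
    have : (((k + ν - 2 : ℤ) : ℂ) + 1) = (k : ℂ) + ((2 * ν : ℕ) : ℂ) - ν - 1 := by
      push_cast
      ring
    rw [this]
  have hodd : Odd n → taylorOdd k (L 0 0 / 2) (n / 2) φ = taylorSum k (L 0 0 / 2) n φ := by
    rintro ⟨ν, rfl⟩
    ext τ
    have hdiv : (2 * ν + 1) / 2 = ν := by omega
    rw [hdiv]
    simp only [taylorOdd, taylorSum, factorialQuotient_eq_asc, hdiv]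
    have : (((k + ν - 1 : ℤ) : ℂ) + 1) = (k : ℂ) + ((2 * ν + 1 : ℕ) : ℂ) - ν - 1 := by
      push_cast
      ring
    rw [this]
  unfold taylorOp
  rcases Int.even_or_odd k with hk | hk <;> rcases Nat.even_or_odd n with hn | hn
  · simp [hk, hn, heven hn]
  · simp [hk, Nat.not_even_iff_odd.2 hn, Int.not_odd_iff_even.2 hk]
  · simp [Int.not_even_iff_odd.2 hk, hn, Nat.not_odd_iff_even.2 hn]
  · simp [Int.not_even_iff_odd.2 hk, Nat.not_even_iff_odd.2 hn, hk, hn, hodd hn]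

theorem IsJacobiForm.exists_taylorOp (hφ : IsJacobiForm k L φ) (n : ℕ) :
    ∃ f : ModularForm 𝒮ℒ (k + n), ⇑f = taylorOp k L n φ := by
  rw [taylorOp_eq]
  split_ifs
  · exact hφ.exists_taylorSum n
  · exact ⟨0, rfl⟩

theorem taylorOp_heckeV (hφ : IsHolo φ) {l : ℕ} (hl : 0 < l) (n : ℕ) :
    taylorOp k ((l : ℤ) • L) n (heckeV k L l φ) = heckeT (k + n) l (taylorOp k L n φ) := by
  rw [taylorOp_eq, taylorOp_eq]
  split_ifs
  · rw [← taylorSum_heckeV hφ hl]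
    congr 1
    rw [Matrix.smul_apply, smul_eq_mul, Int.cast_mul, Int.cast_natCast, mul_div_assoc]
  · ext τ
    simp [heckeT, heckeTTerm]

end Taylor

theorem indexPullback_zsmul {N N' : ℕ} (a : ℤ) (L : Matrix (Fin N) (Fin N) ℤ)
    (s : Matrix (Fin N) (Fin N') ℤ) : indexPullback (a • L) s = a • indexPullback L s := by
  rw [indexPullback, indexPullback, Matrix.mul_smul, Matrix.smul_mul]

end JacobiHecke

end

open JacobiHecke in
theorem mainTheorem7 {N : ℕ} (k : ℤ) (L : Matrix (Fin N) (Fin N) ℤ) (hL : IsJacobiIndex L)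
    (l : ℕ) (hl : 0 < l) :
    -- the summands of `V_l` and of `T_l` only depend on the cosets
    (∀ φ : ℍ → (Fin N → ℂ) → ℂ, (∀ γ : SL(2, ℤ), jacobiSlash k L γ 0 0 φ = φ) →
      ∀ (γ : SL(2, ℤ)) (M : FixedDetMatrix (Fin 2) ℤ (l : ℤ)),
        heckeVTerm k L l φ (γ • M) = heckeVTerm k L l φ M) ∧
    (∀ (κ : ℤ) (f : ModularForm 𝒮ℒ κ) (γ : SL(2, ℤ)) (M : FixedDetMatrix (Fin 2) ℤ (l : ℤ)),
        heckeTTerm κ l f (γ • M) = heckeTTerm κ l f M) ∧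
    -- restriction commutes with `V_l`
    (∀ (N' : ℕ) (s : Matrix (Fin N) (Fin N') ℤ) (φ : ℍ → (Fin N → ℂ) → ℂ),
      heckeV k (indexPullback L s) l (restrict s φ) = restrict s (heckeV k L l φ)) ∧
    (∀ (N' : ℕ) (s : Matrix (Fin N) (Fin N') ℤ) (φ : ℍ → (Fin N → ℂ) → ℂ), IsJacobiForm k L φ →
      IsJacobiForm k (indexPullback L s) (restrict s φ)) ∧
    -- the horizontal arrows of the diagram
    (∀ φ : ℍ → (Fin N → ℂ) → ℂ, IsJacobiForm k L φ →
      IsJacobiForm k ((l : ℤ) • L) (heckeV k L l φ)) ∧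
    (∀ (κ : ℤ) (f : ModularForm 𝒮ℒ κ), ∃ g : ModularForm 𝒮ℒ κ, ⇑g = heckeT κ l f) ∧
    -- the vertical arrows of the diagram, and its commutativity
    (∀ (s : Matrix (Fin N) (Fin 1) ℤ) (n : ℕ) (φ : ℍ → (Fin N → ℂ) → ℂ), IsJacobiForm k L φ →
      ∃ f g : ModularForm 𝒮ℒ (k + n),
        ⇑f = taylorOp k (indexPullback L s) n (restrict s φ) ∧
        ⇑g = taylorOp k (indexPullback ((l : ℤ) • L) s) n (restrict s (heckeV k L l φ)) ∧
        ⇑g = heckeT (k + n) l f) := by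
  refine ⟨fun φ hφ γ M => ?_, fun κ f γ M => ?_, fun N' s φ => heckeV_restrict k L s φ l,
    fun N' s φ hφ => hφ.restrict s, fun φ hφ => hφ.heckeV hL hl,
    fun κ f => exists_modularForm_heckeT κ hl f, fun s n φ hφ => ?_⟩
  · rw [heckeVTerm_eq_slashMat, heckeVTerm_eq_slashMat]
    exact slashMat_smul hl (fun γ => by rw [← jacobiSlash_zero_eq_slashMat, hφ]) γ M
  · ext τ
    rw [← heckeTTerm_eq_heckeVTerm κ l f _ τ 0, ← heckeTTerm_eq_heckeVTerm κ l f _ τ 0,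
      heckeVTerm_eq_slashMat, heckeVTerm_eq_slashMat,
      slashMat_smul hl (isJacobiForm_of_modularForm κ f).slashMat_eq]
  · obtain ⟨f, hf⟩ := (hφ.restrict s).exists_taylorOp n
    obtain ⟨g, hg⟩ := ((hφ.heckeV hL hl).restrict s).exists_taylorOp n
    refine ⟨f, g, hf, hg, ?_⟩
    -- As V_l commutes with restriction, the claim is the rank one case for the restricted form.
    rw [hg, hf, ← heckeV_restrict, indexPullback_zsmul]
    exact taylorOp_heckeV (hφ.restrict s).holo hl n
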